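/- Let $\mathbb F$ be a finite field with $q$ elements and let $X$ be a Noetherian scheme over $\mathbb F$ which is $F$-finite, i.e. the $q$-power Frobenius $F\colon X\to X$ (the identity on the underlying space and $r\mapsto r^q$ on sections of $\mathcal O_X$) is a finite morphism. A coherent Cartier module on $X$ is a coherent $\mathcal O_X$-module $M$ with an $\mathcal O_X$-linear map $C\colon F_*M\to M$; maps of Cartier modules are the $\mathcal O_X$-linear maps commuting with $C$. For an $\mathcal O_X$-submodule $N\subseteq M$ let $C(N)\subseteq M$ be the image of $F_*N\to F_*M\to M$; a Cartier submodule is a quasi-coherent submodule $N$ with $C(N)\subseteq N$. A Cartier module $M$ is nilpotent if $C^e(M)=0$ for some $e$; a map of coherent Cartier modules is a nil-isomorphism if its kernel and cokernel are nilpotent. The category of Cartier crystals is the localization of the category of coherent Cartier modules at the nil-isomorphisms; the crystal associated with $M$ is the image of $M$ in this localization, and a subcrystal is a subobject (isomorphism class of monomorphisms) in this category. Then: 1. For every coherent Cartier module $M$ on $X$ there are only finitely many quasi-coherent submodules $N\subseteq M$ with $C(N)=N$. 2. Every coherent Cartier module $M$ on $X$ has, up to nilpotence, only finitely many Cartier submodules,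 where two Cartier submodules $N,N'\subseteq M$ are equal up to nilpotence if $C^n(N)=C^n(N')$ for all sufficiently large $n$. 3. Every Cartier crystal on $X$ has only finitely many subcrystals. 4. Let $M$ be a coherent Cartier module with associated crystal $\mathcal M$. For every Cartier submodule $N\subseteq M$, the inclusion $N\hookrightarrow M$ induces a monomorphism from the crystal $\mathcal N$ of $N$ to $\mathcal M$. The assignment $N\mapsto\mathcal N$ is a bijection from the quasi-coherent submodules $N\subseteq M$ with $C(N)=N$ to the subcrystals of $\mathcal M$, and for two such submodules $N,N'$ one has $N\subseteq N'$ if and only if $\mathcal N\subseteq\mathcal N'$ as subcrystals of $\mathcal M$. -/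

import Mathlib

open AlgebraicGeometry CategoryTheory CategoryTheory.Limits Opposite

universe u

noncomputable section

namespace CartierModules

/-! ### The `q`-power Frobenius of a scheme over a finite field with `q` elements -/

section Frobenius

variable {𝔽 : Type u} [Field 𝔽] [Fintype 𝔽] {X : Scheme.{u}}

/-- The `q`-power map on the sections of `𝒪_X`, where `X` is a scheme over `𝔽` and `q = #𝔽`. -/
def frobSection (s : X ⟶ Spec (CommRingCat.of 𝔽)) (U : X.Opens) : Γ(X, U) →+* Γ(X, U) :=
  letI : Algebra 𝔽 Γ(X, U) :=
    ((Scheme.ΓSpecIso (CommRingCat.of 𝔽)).inv ≫ s.appTop ≫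
      X.presheaf.map (homOfLE (le_top : U ≤ ⊤)).op).hom.toAlgebra
  (FiniteField.frobeniusAlgHom 𝔽 Γ(X, U)).toRingHom

theorem frobSection_apply (s : X ⟶ Spec (CommRingCat.of 𝔽)) (U : X.Opens) (r : Γ(X, U)) :
    frobSection s U r = r ^ Fintype.card 𝔽 := rfl

/-- The `q`-power Frobenius as a morphism of presheafed spaces. -/
def frobPresheafed (s : X ⟶ Spec (CommRingCat.of 𝔽)) :
    X.toPresheafedSpace ⟶ X.toPresheafedSpace where
  base := 𝟙 _
  c :=
    { app := fun U => CommRingCat.ofHom (frobSection s U.unop)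
      naturality := by
        intro U V i
        ext r
        exact (map_pow (X.presheaf.map i).hom r (Fintype.card 𝔽)).symm }

theorem frobPresheafed_stalk (s : X ⟶ Spec (CommRingCat.of 𝔽)) (x : X)
    (a : X.presheaf.stalk x) :
    (frobPresheafed s).stalkMap x a = a ^ Fintype.card 𝔽 := by
  obtain ⟨U, hx, r, rfl⟩ := X.presheaf.exists_germ_eq a
  refine (PresheafedSpace.stalkMap_germ_apply (frobPresheafed s) U x hx r).trans ?_
  exact map_pow (X.presheaf.germ U x hx).hom r (Fintype.card 𝔽)

/-- The `q`-power Frobenius morphism `F : X ⟶ X`: the identity on the underlying space and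
`r ↦ r ^ q` on sections of `𝒪_X`. -/
def frobenius (s : X ⟶ Spec (CommRingCat.of 𝔽)) : X ⟶ X where
  toLRSHom' :=
    { toHom := frobPresheafed s
      prop := fun x => ⟨fun a ha => by
        have h : IsUnit (a ^ Fintype.card 𝔽) := frobPresheafed_stalk s x a ▸ ha
        exact (isUnit_pow_iff Fintype.card_ne_zero).1 h⟩ }

theorem frobenius_preimage (s : X ⟶ Spec (CommRingCat.of 𝔽)) (U : X.Opens) :
    frobenius s ⁻¹ᵁ U = U := rfl

theorem frobenius_app (s : X ⟶ Spec (CommRingCat.of 𝔽)) (U : X.Opens) (r : Γ(X, U)) :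
    (frobenius s).app U r = r ^ Fintype.card 𝔽 := rfl

end Frobenius

/-! ### Coherent Cartier modules -/

/-- A sheaf of modules on a locally Noetherian scheme is coherent if it is quasi-coherent and its
sections over every affine open form a finite module. -/
structure IsCoherent {X : Scheme.{u}} (M : X.Modules) : Prop where
  quasicoherent : M.IsQuasicoherent
  finite : ∀ U : X.Opens, IsAffineOpen U → Module.Finite Γ(X, U) Γ(M, U)

theorem IsCoherent.of_mono {X : Scheme.{u}} [IsLocallyNoetherian X] {N M : X.Modules}
    (hM : IsCoherent M) (i : N ⟶ M) [Mono i] (hN : N.IsQuasicoherent) : IsCoherent N where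
  quasicoherent := hN
  finite U hU := by
    have : IsNoetherianRing Γ(X, U) := IsLocallyNoetherian.component_noetherian ⟨U, hU⟩
    have := hM.finite U hU
    have : PreservesLimits (Scheme.Modules.toPresheaf X) := inferInstance
    have : PreservesLimit (cospan i i) (Scheme.Modules.toPresheaf X) := inferInstance
    have hm : Mono (((Scheme.Modules.toPresheaf X).map i).app (op U)) :=
      (NatTrans.mono_iff_mono_app _).1 ((Scheme.Modules.toPresheaf X).map_mono i) (op U)
    have hinj : Function.Injective (i.app U) :=
      (AddCommGrpCat.mono_iff_injective _).1 hm
    let f : Γ(N, U) →ₗ[Γ(X, U)] Γ(M, U) :=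
      { toFun := i.app U
        map_add' := map_add _
        map_smul' := fun r x => Scheme.Modules.Hom.app_smul i r x }
    exact Module.Finite.of_injective f hinj

section Cartier

variable {𝔽 : Type u} [Field 𝔽] [Fintype 𝔽] {X : Scheme.{u}}

/-- A coherent Cartier module: a coherent `𝒪_X`-module `M` with an `𝒪_X`-linear structural map
`C : F_* M ⟶ M`. -/
structure CohCart (s : X ⟶ Spec (CommRingCat.of 𝔽)) where
  module : X.Modules
  coherent : IsCoherent module
  C : (Scheme.Modules.pushforward (frobenius s)).obj module ⟶ module

variable {s : X ⟶ Spec (CommRingCat.of 𝔽)}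

/-- A map of Cartier modules is an `𝒪_X`-linear map commuting with the structural maps. -/
@[ext]
structure CohCart.Hom (M N : CohCart s) where
  hom : M.module ⟶ N.module
  comm : (Scheme.Modules.pushforward (frobenius s)).map hom ≫ N.C = M.C ≫ hom

instance : Category (CohCart s) where
  Hom M N := CohCart.Hom M N
  id M := ⟨𝟙 _, by simp⟩
  comp f g := ⟨f.hom ≫ g.hom, by
    rw [Functor.map_comp, Category.assoc, g.comm, ← Category.assoc, f.comm, Category.assoc]⟩

namespace CohCart

/-- On sections the structural map is an additive map with `C(r ^ q • m) = r • C(m)`. -/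
theorem C_pow_smul (M : CohCart s) (U : X.Opens) (r : Γ(X, U)) (m : Γ(M.module, U)) :
    M.C.app U ((r ^ Fintype.card 𝔽 • m : Γ(M.module, U))) = r • M.C.app U m :=
  Scheme.Modules.Hom.app_smul M.C r m

/-- `C(N)`, for an `𝒪_X`-submodule `N` of `M`: the image of `F_* N ⟶ F_* M ⟶ M`. -/
def image (M : CohCart s) (N : Subobject M.module) : Subobject M.module :=
  imageSubobject ((Scheme.Modules.pushforward (frobenius s)).map N.arrow ≫ M.C)

/-- `C^e(N)`. -/
def imageIter (M : CohCart s) (e : ℕ) (N : Subobject M.module) : Subobject M.module :=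
  M.image^[e] N

/-- A Cartier submodule of `M`: a quasi-coherent submodule `N` with `C(N) ⊆ N`. -/
abbrev CartierSubmodule (M : CohCart s) : Type (u + 1) :=
  {N : Subobject M.module // (N : X.Modules).IsQuasicoherent ∧ M.image N ≤ N}

/-- A quasi-coherent submodule `N` of `M` with `C(N) = N`. -/
abbrev FixedSubmodule (M : CohCart s) : Type (u + 1) :=
  {N : Subobject M.module // (N : X.Modules).IsQuasicoherent ∧ M.image N = N}

/-- A submodule with `C(N) = N` is a Cartier submodule. -/
def FixedSubmodule.toCartierSubmodule {M : CohCart s} (N : M.FixedSubmodule) :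
    M.CartierSubmodule :=
  ⟨N.1, N.2.1, N.2.2.le⟩

theorem factors_of_image_le (M : CohCart s) (N : Subobject M.module) (h : M.image N ≤ N) :
    N.Factors ((Scheme.Modules.pushforward (frobenius s)).map N.arrow ≫ M.C) := by
  refine Subobject.factors_of_le _ h ?_
  have := imageSubobject_factors_comp_self
    (f := (Scheme.Modules.pushforward (frobenius s)).map N.arrow ≫ M.C) (𝟙 _)
  rwa [Category.id_comp] at this

/-- A Cartier submodule, regarded as a coherent Cartier module with the restricted structural
map. -/
def CartierSubmodule.toCohCart [IsLocallyNoetherian X] {M : CohCart s} (N : M.CartierSubmodule) :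
    CohCart s where
  module := (N.1 : X.Modules)
  coherent := M.coherent.of_mono N.1.arrow N.2.1
  C := N.1.factorThru _ (M.factors_of_image_le N.1 N.2.2)

/-- The inclusion of a Cartier submodule. -/
def CartierSubmodule.incl [IsLocallyNoetherian X] {M : CohCart s} (N : M.CartierSubmodule) :
    N.toCohCart ⟶ M where
  hom := N.1.arrow
  comm := (N.1.factorThru_arrow _ (M.factors_of_image_le N.1 N.2.2)).symm

/-- Two Cartier submodules `N`, `N'` of `M` are equal up to nilpotence if the stable values of the
descending sequences `C^n(N)` and `C^n(N')` agree, i.e. if `C^n(N) = C^n(N')` for all large `n`. -/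
def equalUpToNilpotence (M : CohCart s) : Setoid M.CartierSubmodule where
  r N N' := ∃ e, ∀ n ≥ e, M.imageIter n N.1 = M.imageIter n N'.1
  iseqv :=
    { refl := fun _ => ⟨0, fun _ _ => rfl⟩
      symm := fun ⟨e, h⟩ => ⟨e, fun n hn => (h n hn).symm⟩
      trans := fun ⟨e, h⟩ ⟨e', h'⟩ => ⟨max e e', fun n hn =>
        (h n (le_trans (le_max_left _ _) hn)).trans (h' n (le_trans (le_max_right _ _) hn))⟩ }

end CohCart

/-! ### Cartier crystals -/

/-- A map `φ : M ⟶ N` of coherent Cartier modules is a nil-isomorphism if its kernel and its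
cokernel are nilpotent: `C^e(ker φ) = 0` and `C^e(N / im φ) = 0`, the latter meaning
`C^e(N) ⊆ im φ`, for some `e`. -/
def nilIso (s : X ⟶ Spec (CommRingCat.of 𝔽)) : MorphismProperty (CohCart s) :=
  fun M N φ =>
    (∃ e, M.imageIter e (kernelSubobject φ.hom) = ⊥) ∧
      (∃ e, N.imageIter e ⊤ ≤ imageSubobject φ.hom)

/-- The category of Cartier crystals: the localization of the category of coherent Cartier modules
at the nil-isomorphisms. -/
abbrev Crys (s : X ⟶ Spec (CommRingCat.of 𝔽)) := (nilIso s).Localization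

/-- The functor sending a coherent Cartier module to its associated crystal. -/
abbrev toCrys (s : X ⟶ Spec (CommRingCat.of 𝔽)) : CohCart s ⥤ Crys s := (nilIso s).Q

end Cartier

end CartierModules

end

/-! ### Modules with a `q⁻¹`-linear operator -/

section CartierOperators

open Module

/-- A `q⁻¹`-linear operator on a module: an additive map `C` with `C (r ^ q • m) = r • C m`. -/
structure CartierOp (q : ℕ) (R : Type*) [CommRing R] (M : Type*) [AddCommGroup M]
    [Module R M] extends M →+ M where
  pow_smul' : ∀ (r : R) (m : M), toFun (r ^ q • m) = r • toFun m

namespace CartierOp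

variable {q : ℕ} {R : Type*} [CommRing R] {M : Type*} [AddCommGroup M] [Module R M]

instance : FunLike (CartierOp q R M) M M where
  coe C := C.toFun
  coe_injective C C' h := by
    rcases C with ⟨C, hC⟩
    rcases C' with ⟨C', hC'⟩
    congr 1
    exact DFunLike.coe_injective h

instance : AddMonoidHomClass (CartierOp q R M) M M where
  map_add C := C.map_add'
  map_zero C := C.map_zero'

theorem pow_smul (C : CartierOp q R M) (r : R) (m : M) : C (r ^ q • m) = r • C m :=
  C.pow_smul' r m

/-- The submodule `C(N)`. -/
def image (C : CartierOp q R M) (N : Submodule R M) : Submodule R M where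
  carrier := C '' N
  add_mem' := by
    rintro _ _ ⟨a, ha, rfl⟩ ⟨b, hb, rfl⟩
    exact ⟨a + b, N.add_mem ha hb, map_add C a b⟩
  zero_mem' := ⟨0, N.zero_mem, map_zero C⟩
  smul_mem' := by
    rintro r _ ⟨a, ha, rfl⟩
    exact ⟨r ^ q • a, N.smul_mem _ ha, C.pow_smul r a⟩

variable (C : CartierOp q R M)

theorem mem_image {N : Submodule R M} {x : M} : x ∈ C.image N ↔ ∃ y ∈ N, C y = x := Iff.rfl

theorem apply_mem_image {N : Submodule R M} {x : M} (h : x ∈ N) : C x ∈ C.image N := ⟨x, h, rfl⟩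

theorem image_le_iff {N N' : Submodule R M} : C.image N ≤ N' ↔ ∀ x ∈ N, C x ∈ N' :=
  ⟨fun h x hx => h ⟨x, hx, rfl⟩, by rintro h _ ⟨x, hx, rfl⟩; exact h x hx⟩

theorem image_mono : Monotone C.image := fun _ _ h => C.image_le_iff.2
  fun _ hx => C.apply_mem_image (h hx)

theorem image_sup (N N' : Submodule R M) : C.image (N ⊔ N') = C.image N ⊔ C.image N' := by
  refine le_antisymm (C.image_le_iff.2 fun x hx => ?_)
    (sup_le (C.image_mono le_sup_left) (C.image_mono le_sup_right))
  obtain ⟨a, ha, b, hb, rfl⟩ := Submodule.mem_sup.1 hx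
  rw [map_add]
  exact Submodule.add_mem_sup (C.apply_mem_image ha) (C.apply_mem_image hb)

theorem iterate_image_antitone {N : Submodule R M} (h : C.image N ≤ N) :
    Antitone fun n => C.image^[n] N :=
  C.image_mono.antitone_iterate_of_map_le h

theorem iterate_image_le {N : Submodule R M} (h : C.image N ≤ N) (n : ℕ) :
    C.image^[n] N ≤ N :=
  C.iterate_image_antitone h (Nat.zero_le n)

/-- If `M` has no nonzero submodule killed by `C`, the same holds for the powers of `C`. -/
theorem iterate_image_ne_bot (hnil : ∀ N : Submodule R M, C.image N = ⊥ → N = ⊥)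
    {N : Submodule R M} (h : N ≠ ⊥) (n : ℕ) : C.image^[n] N ≠ ⊥ := by
  induction n with
  | zero => exact h
  | succ n ih =>
    rw [Function.iterate_succ_apply']
    exact fun h' => ih (hnil _ h')

theorem le_of_image_eq {N L : Submodule R M} (hN : C.image N = N) (h : N ≤ L) (n : ℕ) :
    N ≤ C.image^[n] L := by
  induction n with
  | zero => exact h
  | succ n ih =>
    rw [Function.iterate_succ_apply', ← hN]
    exact C.image_mono ih

/-- The operator induced on a quotient. -/
def quot (L : Submodule R M) (hL : C.image L ≤ L) : CartierOp q R (M ⧸ L) where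
  __ := (QuotientAddGroup.map L.toAddSubgroup L.toAddSubgroup C.toAddMonoidHom
    (fun x hx => hL ⟨x, hx, rfl⟩) : M ⧸ L.toAddSubgroup →+ M ⧸ L.toAddSubgroup)
  pow_smul' := by
    intro r m
    obtain ⟨m, rfl⟩ := L.mkQ_surjective m
    exact congrArg L.mkQ (C.pow_smul r m)

theorem quot_image_map {L : Submodule R M} (hL : C.image L ≤ L) (N : Submodule R M) :
    (C.quot L hL).image (N.map L.mkQ) = (C.image N).map L.mkQ := by
  apply le_antisymm
  · rw [image_le_iff]
    rintro _ ⟨x, hx, rfl⟩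
    exact ⟨C x, C.apply_mem_image hx, rfl⟩
  · rintro _ ⟨_, ⟨x, hx, rfl⟩, rfl⟩
    exact ⟨L.mkQ x, ⟨x, hx, rfl⟩, rfl⟩

theorem quot_iterate_image_map {L : Submodule R M} (hL : C.image L ≤ L) (n : ℕ)
    (N : Submodule R M) :
    (C.quot L hL).image^[n] (N.map L.mkQ) = (C.image^[n] N).map L.mkQ := by
  induction n with
  | zero => rfl
  | succ n ih => rw [Function.iterate_succ_apply', Function.iterate_succ_apply', ih,
      quot_image_map]

/-- The operator induced on a stable submodule. -/
def restrict (N : Submodule R M) (hN : C.image N ≤ N) : CartierOp q R N where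
  toFun x := ⟨C x, hN ⟨x, x.2, rfl⟩⟩
  map_zero' := Subtype.ext (map_zero C)
  map_add' _ _ := Subtype.ext (map_add C _ _)
  pow_smul' r x := Subtype.ext (C.pow_smul r x)

theorem restrict_image_map {N : Submodule R M} (hN : C.image N ≤ N) (L : Submodule R N) :
    ((C.restrict N hN).image L).map N.subtype = C.image (L.map N.subtype) := by
  apply le_antisymm
  · rintro _ ⟨_, ⟨x, hx, rfl⟩, rfl⟩
    exact ⟨x, ⟨x, hx, rfl⟩, rfl⟩
  · rintro _ ⟨_, ⟨x, hx, rfl⟩, rfl⟩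
    exact ⟨C.restrict N hN x, ⟨x, hx, rfl⟩, rfl⟩

theorem restrict_iterate_image_map {N : Submodule R M} (hN : C.image N ≤ N) (n : ℕ)
    (L : Submodule R N) :
    ((C.restrict N hN).image^[n] L).map N.subtype = C.image^[n] (L.map N.subtype) := by
  induction n with
  | zero => rfl
  | succ n ih => rw [Function.iterate_succ_apply', Function.iterate_succ_apply', restrict_image_map,
      ih]

/-- The submodule of elements killed by an ideal is stable. -/
theorem image_torsionBySet_le (hq : q ≠ 0) (I : Ideal R) :
    C.image (Submodule.torsionBySet R M I) ≤ Submodule.torsionBySet R M I := by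
  rw [image_le_iff]
  intro x hx
  rw [Submodule.mem_torsionBySet_iff] at hx ⊢
  rintro ⟨a, ha⟩
  have := hx ⟨a ^ q, I.pow_mem_of_mem ha q (Nat.pos_of_ne_zero hq)⟩
  change a ^ q • x = 0 at this
  change a • C x = 0
  rw [← C.pow_smul, this, map_zero]

end CartierOp

/-- Induction over quotients: a property of finite modules with operators holds for all of them
if it holds for `M` as soon as it holds for all proper quotients of `M`. -/
theorem CartierOp.quotient_induction {q : ℕ} {R : Type*} [CommRing R] [IsNoetherianRing R]
    {P : ∀ (M : Type u) [AddCommGroup M] [Module R M], CartierOp q R M → Prop}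
    (step : ∀ (M : Type u) [AddCommGroup M] [Module R M] [Module.Finite R M]
      (C : CartierOp q R M),
      (∀ (L : Submodule R M) (hL : C.image L ≤ L), L ≠ ⊥ → P (M ⧸ L) (C.quot L hL)) → P M C)
    (M : Type u) [AddCommGroup M] [Module R M] [Module.Finite R M] (C : CartierOp q R M) :
    P M C := by
  -- A quotient of a quotient is not literally a quotient of `M`, so the induction runs over
  -- surjections out of the fixed module `M`, ordered by their kernels.
  suffices H : ∀ (K : Submodule R M) (M' : Type u) [AddCommGroup M'] [Module R M']
      (C' : CartierOp q R M') (f : M →ₗ[R] M'), Function.Surjective f → LinearMap.ker f = K →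
      P M' C' from
    H ⊥ M C LinearMap.id Function.surjective_id LinearMap.ker_id
  intro K
  induction K using WellFoundedGT.induction with | ind K ih => ?_
  intro M' _ _ C' f hf hK
  have : Module.Finite R M' := Module.Finite.of_surjective f hf
  refine step M' C' fun L hL hL0 => ?_
  refine ih (LinearMap.ker (L.mkQ ∘ₗ f)) ?_ _ _ (L.mkQ ∘ₗ f) (L.mkQ_surjective.comp hf) rfl
  rw [LinearMap.ker_comp, Submodule.ker_mkQ, ← hK]
  refine lt_of_le_of_ne (LinearMap.ker_le_comap f) fun h => hL0 ?_
  rw [← Submodule.map_comap_eq_of_surjective hf L, ← h, eq_bot_iff]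
  rintro _ ⟨x, hx, rfl⟩
  exact hx

end CartierOperators

/-! ### Generic rank of finite modules over a domain. -/

section GenericRank

open Module

/-- A submodule of full rank of a finite module over a domain contains a nonzero multiple of the
module. -/
theorem Submodule.exists_smul_mem_of_finrank_eq {D E : Type*} [CommRing D] [IsDomain D]
    [AddCommGroup E] [Module D E] [Module.Finite D E] (N : Submodule D E)
    (h : finrank D N = finrank D E) : ∃ c : D, c ≠ 0 ∧ ∀ x, c • x ∈ N := by
  have h1 := N.finrank_quotient_add_finrank
  have h2 : finrank D (E ⧸ N) = 0 := by omega
  have h3 := Module.finrank_eq_zero_iff_isTorsion.1 h2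
  obtain ⟨c, hc, hc0⟩ := Submodule.annihilator_top_inter_nonZeroDivisors h3
  refine ⟨c, nonZeroDivisors.ne_zero hc0, fun x => ?_⟩
  have := Submodule.mem_annihilator.1 hc (N.mkQ x) trivial
  rwa [← map_smul, Submodule.mkQ_apply, Submodule.Quotient.mk_eq_zero] at this

/-- A finite module over a domain has a maximal linearly independent family, which spans a
nonzero multiple of the module. -/
theorem Module.exists_linearIndependent_smul_mem_span (D E : Type*) [CommRing D] [IsDomain D]
    [AddCommGroup E] [Module D E] [Module.Finite D E] :
    ∃ b : Fin (finrank D E) → E, LinearIndependent D b ∧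
      ∃ c : D, c ≠ 0 ∧ ∀ x, c • x ∈ Submodule.span D (Set.range b) := by
  obtain ⟨b, hb⟩ := exists_linearIndependent_of_le_finrank (R := D) (M := E) le_rfl
  exact ⟨b, hb, Submodule.exists_smul_mem_of_finrank_eq _
    (by rw [finrank_span_eq_card hb, Fintype.card_fin])⟩

theorem Module.finrank_fin_fun_of_isDomain (D E : Type*) [CommRing D] [IsDomain D]
    [AddCommGroup E] [Module D E] [Module.Finite D E] (d : ℕ) :
    finrank D (Fin d → E) = d * finrank D E := by
  obtain ⟨b, hb, c, hc, hcb⟩ := Module.exists_linearIndependent_smul_mem_span D E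
  let f : (Fin d → (Fin (finrank D E) → D)) →ₗ[D] (Fin d → E) :=
    (Fintype.linearCombination D b).compLeft (Fin d)
  have hf : Function.Injective f := by
    intro x y hxy
    funext i
    exact linearIndependent_iff_injective_fintypeLinearCombination.1 hb (congrFun hxy i)
  have h1 := (LinearMap.range f).finrank_quotient_add_finrank
  rw [LinearMap.finrank_range_of_inj hf] at h1
  have h2 : finrank D ((Fin d → E) ⧸ LinearMap.range f) = 0 := by
    rw [Module.finrank_eq_zero_iff]
    intro x
    obtain ⟨x, rfl⟩ := (LinearMap.range f).mkQ_surjective x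
    refine ⟨c, hc, ?_⟩
    rw [← map_smul, Submodule.mkQ_apply, Submodule.Quotient.mk_eq_zero]
    have : ∀ i, ∃ y : Fin (finrank D E) → D, Fintype.linearCombination D b y = c • x i := by
      intro i
      have := hcb (x i)
      rwa [← Fintype.range_linearCombination] at this
    choose y hy using this
    exact ⟨y, funext hy⟩
  rw [h2, zero_add, Module.finrank_pi_fintype] at h1
  simpa using h1.symm

end GenericRank

/-! ### Generically minimal stable submodules and stabilization of `C^n`. -/

namespace CartierOp

open Module

variable {q : ℕ} {R : Type*} [CommRing R] {M : Type*} [AddCommGroup M] [Module R M]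
variable (C : CartierOp q R M)

/-- A nonzero finite module with operator over a Noetherian ring contains a nonzero stable
submodule `T`, torsion-free over `R ⧸ P` for a prime `P`, all whose nonzero stable submodules agree
with `T` generically. -/
theorem exists_generically_minimal [IsNoetherianRing R] [Module.Finite R M] [Nontrivial M]
    (hq : q ≠ 0) :
    ∃ (P : Ideal R) (T : Submodule R M), P.IsPrime ∧ C.image T ≤ T ∧ T ≠ ⊥ ∧
      (∀ r ∈ P, ∀ t ∈ T, r • t = 0) ∧ (∀ r ∉ P, ∀ t ∈ T, r • t = 0 → t = 0) ∧
      ∀ N ≤ T, C.image N ≤ N → N ≠ ⊥ → ∃ r ∉ P, ∀ x ∈ T, r • x ∈ N := by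
  -- `P` is maximal among annihilators of nonzero elements. This makes it prime, and makes the
  -- `P`-torsion of `M` torsion-free over `R ⧸ P`.
  obtain ⟨P, ⟨x, hx0, hxP⟩, hmax⟩ := (wellFounded_gt (α := Ideal R)).has_min
    {I : Ideal R | ∃ x : M, x ≠ 0 ∧ I = Ideal.torsionOf R M x}
    (by obtain ⟨x, hx⟩ := exists_ne (0 : M); exact ⟨_, x, hx, rfl⟩)
  have hP_eq : ∀ y : M, y ≠ 0 → P ≤ Ideal.torsionOf R M y → Ideal.torsionOf R M y = P := by
    intro y hy hle
    by_contra hne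
    exact hmax _ ⟨y, hy, rfl⟩ (lt_of_le_of_ne hle (Ne.symm hne))
  have hP : P.IsPrime := by
    refine ⟨?_, ?_⟩
    · rw [hxP, Ne, Ideal.eq_top_iff_one, Ideal.mem_torsionOf_iff, one_smul]
      exact hx0
    · intro a b hab
      by_cases hb : b • x = 0
      · right
        rwa [hxP]
      · left
        rw [← hP_eq (b • x) hb]
        · rw [hxP] at hab
          rwa [Ideal.mem_torsionOf_iff, smul_smul]
        · intro r hr
          rw [hxP, Ideal.mem_torsionOf_iff] at hr
          rw [Ideal.mem_torsionOf_iff, smul_comm, hr, smul_zero]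
  let U := Submodule.torsionBySet R M P
  have hU : ∀ {t}, t ∈ U ↔ ∀ r ∈ P, r • t = 0 := by
    intro t
    rw [Submodule.mem_torsionBySet_iff]
    exact ⟨fun h r hr => h ⟨r, hr⟩, fun h r => h r r.2⟩
  have hUfree : ∀ r ∉ P, ∀ t ∈ U, r • t = 0 → t = 0 := by
    intro r hr t ht h
    by_contra h0
    exact hr (hP_eq t h0 (fun a ha => hU.1 ht a ha) ▸ h)
  let g : Submodule R M → Submodule (R ⧸ P) U := fun N =>
    { carrier := {u | (u : M) ∈ N}
      add_mem' := fun ha hb => N.add_mem ha hb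
      zero_mem' := N.zero_mem
      smul_mem' := by
        intro c u hu
        obtain ⟨c, rfl⟩ := Ideal.Quotient.mk_surjective c
        exact N.smul_mem c hu }
  have : Module.Finite (R ⧸ P) U := Module.Finite.of_restrictScalars_finite R (R ⧸ P) U
  -- Minimal rank over `R ⧸ P`: a nonzero stable submodule of `T` must have the same rank, so its
  -- quotient in `T` is torsion.
  obtain ⟨T, ⟨hTU, hTC, hT0⟩, hmin⟩ :=
    (InvImage.wf (fun N : Submodule R M => finrank (R ⧸ P) (g N)) wellFounded_lt).has_min
      {N : Submodule R M | N ≤ U ∧ C.image N ≤ N ∧ N ≠ ⊥}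
      ⟨U, le_rfl, C.image_torsionBySet_le hq P, fun h => hx0 (by
        rw [← Submodule.mem_bot R, ← h, hU]
        intro r hr
        rwa [hxP] at hr)⟩
  refine ⟨P, T, hP, hTC, hT0, fun r hr t ht => hU.1 (hTU ht) r hr,
    fun r hr t ht => hUfree r hr t (hTU ht), fun N hNT hNC hN0 => ?_⟩
  have hle : g N ≤ g T := fun u hu => hNT hu
  have hfin : IsNoetherian (R ⧸ P) U := isNoetherian_of_isNoetherianRing_of_finite _ _
  have h1 : finrank (R ⧸ P) (g N) = finrank (R ⧸ P) (g T) :=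
    le_antisymm (Submodule.finrank_mono hle)
      (not_lt.1 fun h => hmin N ⟨hNT.trans hTU, hNC, hN0⟩ h)
  obtain ⟨c, hc0, hc⟩ := Submodule.exists_smul_mem_of_finrank_eq ((g N).submoduleOf (g T))
    (by rw [← h1]; exact (Submodule.submoduleOfEquivOfLe hle).finrank_eq)
  obtain ⟨c, rfl⟩ := Ideal.Quotient.mk_surjective c
  refine ⟨c, fun h => hc0 (Ideal.Quotient.eq_zero_iff_mem.2 h), fun x hx => ?_⟩
  exact hc ⟨⟨x, hTU hx⟩, hx⟩

/-- The descending sequence `C^n(M)` is stationary. -/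
theorem exists_iterate_image_top_eq {R : Type*} [CommRing R] [IsNoetherianRing R]
    (hq : 2 ≤ q) (M : Type u) [AddCommGroup M] [Module R M] [Module.Finite R M]
    (C : CartierOp q R M) : ∃ e, C.image^[e + 1] ⊤ = C.image^[e] ⊤ := by
  refine CartierOp.quotient_induction
    (P := fun M _ _ C => ∃ e, C.image^[e + 1] ⊤ = C.image^[e] ⊤) ?_ M C
  intro M _ _ _ C ih
  have hq0 : q ≠ 0 := by omega
  rcases subsingleton_or_nontrivial M with hM | hM
  · exact ⟨0, Subsingleton.elim _ _⟩
  have hanti := C.iterate_image_antitone (N := ⊤) le_top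
  have hquot : ∀ (L : Submodule R M), C.image L ≤ L → L ≠ ⊥ →
      ∃ e, C.image^[e + 1] ⊤ ⊔ L = C.image^[e] ⊤ ⊔ L := by
    intro L hL hL0
    obtain ⟨e, he⟩ := ih L hL hL0
    refine ⟨e, ?_⟩
    have htop : (⊤ : Submodule R (M ⧸ L)) = Submodule.map L.mkQ ⊤ := by
      rw [Submodule.map_top, Submodule.range_mkQ]
    rw [htop, quot_iterate_image_map, quot_iterate_image_map] at he
    have := congrArg (Submodule.comap L.mkQ) he
    rwa [Submodule.comap_map_mkQ, Submodule.comap_map_mkQ, sup_comm, sup_comm L] at this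
  -- A fixed `L` lies in every `C^n(M)`, so stabilization modulo `L` is already stabilization.
  have hfix : ∀ (L : Submodule R M), C.image L = L → L ≠ ⊥ →
      ∃ e, C.image^[e + 1] ⊤ = C.image^[e] ⊤ := by
    intro L hL hL0
    obtain ⟨e, he⟩ := hquot L hL.le hL0
    refine ⟨e, ?_⟩
    rwa [sup_eq_left.2 (C.le_of_image_eq hL le_top _),
      sup_eq_left.2 (C.le_of_image_eq hL le_top _)] at he
  obtain ⟨P, T, hP, hTC, hT0, -, hTfree, hTmin⟩ := C.exists_generically_minimal hq0
  by_cases hCT : C.image T = ⊥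
  -- One more application of `C` removes the summand `T`, at the cost of raising `e` to `e + 1`.
  · obtain ⟨e, he⟩ := hquot T hTC hT0
    refine ⟨e + 1, ?_⟩
    have := congrArg C.image he
    rwa [image_sup, image_sup, hCT, sup_bot_eq, sup_bot_eq, ← Function.iterate_succ_apply' C.image,
      ← Function.iterate_succ_apply' C.image] at this
  obtain ⟨r, hrP, hr⟩ := hTmin _ hTC (C.image_mono hTC) hCT
  obtain ⟨t, htT, ht0⟩ := Submodule.exists_mem_ne_zero_of_ne_bot hT0
  -- the submodule `r² T` is contained in its image
  let L := (Ideal.span {r} ^ 2) • T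
  have hL : L ≤ C.image L := by
    have h1 : L = Submodule.map (LinearMap.lsmul R M (r * r)) T := by
      simp only [L]
      rw [Ideal.span_singleton_pow, Submodule.ideal_span_singleton_smul, sq]
      rfl
    rw [h1]
    rintro _ ⟨x, hx, rfl⟩
    obtain ⟨y, hy, hyx⟩ := hr x hx
    -- With `r x = C y` one has `r² x = r C(y) = C(r ^ q y)` and `r ^ q y = r² (r ^ (q - 2) y)`. The
    -- square is chosen so that `q ≥ 2` is enough.
    refine ⟨r ^ q • y, ⟨r ^ (q - 2) • y, T.smul_mem _ hy, ?_⟩, ?_⟩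
    · simp only [LinearMap.lsmul_apply, smul_smul]
      congr 1
      rw [← sq, ← pow_add]
      congr 1
      omega
    · rw [C.pow_smul, hyx]
      simp [mul_smul]
  have hL0 : L ≠ ⊥ := by
    intro h
    refine hrP (by_contra fun _ => ht0 ?_)
    have : r ^ 2 • t = 0 := by
      rw [← Submodule.mem_bot R, ← h]
      exact Submodule.smul_mem_smul (Ideal.pow_mem_pow (Ideal.mem_span_singleton_self r) 2) htT
    exact hTfree _ (fun h' => hrP (hP.mem_of_pow_mem _ h')) t htT this
  -- The chain now ascends, so Noetherianity stops it, at a fixed submodule containing `L ≠ 0`.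
  have hmono : Monotone fun n => C.image^[n] L := C.image_mono.monotone_iterate_of_le_map hL
  obtain ⟨n, hn⟩ := monotone_stabilizes_iff_noetherian.2 (inferInstance : IsNoetherian R M)
    ⟨_, hmono⟩
  refine hfix (C.image^[n] L) ?_ ?_
  · rw [← Function.iterate_succ_apply' C.image]
    exact (hn (n + 1) (Nat.le_succ n)).symm
  · intro h
    exact hL0 (eq_bot_iff.2 (h ▸ hmono (Nat.zero_le n)))

/-- The descending sequence `C^n(N)` of a stable submodule is stationary. -/
theorem exists_iterate_image_eq {R : Type*} [CommRing R] [IsNoetherianRing R]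
    (hq : 2 ≤ q) {M : Type*} [AddCommGroup M] [Module R M] [Module.Finite R M]
    (C : CartierOp q R M) {N : Submodule R M} (hN : C.image N ≤ N) :
    ∃ e, C.image^[e + 1] N = C.image^[e] N := by
  obtain ⟨e, he⟩ := exists_iterate_image_top_eq hq N (C.restrict N hN)
  refine ⟨e, ?_⟩
  have := congrArg (Submodule.map N.subtype) he
  rwa [restrict_iterate_image_map, restrict_iterate_image_map, Submodule.map_top,
    Submodule.range_subtype] at this

end CartierOp

/-! ### A common multiple of `T` inside all fixed submodules. -/

/-- If `x J ⊆ J²` for a nonzero ideal `J` of a Noetherian domain, then a power of `x` lies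
in `J`. -/
theorem Ideal.exists_pow_mem_of_mul_mem_mul {D : Type*} [CommRing D] [IsDomain D]
    [IsNoetherianRing D] {J : Ideal D} (hJ : J ≠ ⊥) {x : D} (hx : ∀ j ∈ J, x * j ∈ J * J) :
    ∃ n : ℕ, x ^ n ∈ J := by
  -- Cayley–Hamilton for multiplication by `x` on `J`, whose image lies in `J • J`: `p` is monic of
  -- some degree `n`, with coefficient of degree `k` in `J ^ (n - k)`. Once `p(x) = 0` in the
  -- domain, `x ^ n` is a sum of terms in `J`.
  obtain ⟨p, hp, -, hcoeff, hp0⟩ :=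
    LinearMap.exists_monic_and_natDegree_eq_and_coeff_mem_pow_and_aeval_eq_zero D
      (algebraMap D (Module.End D J) x) J (by
        rintro _ ⟨j, rfl⟩
        have h := hx j j.2
        have h' : J * J = Submodule.map J.subtype (J • ⊤) := by
          rw [Submodule.map_smul'', Submodule.map_top, Submodule.range_subtype, smul_eq_mul]
        rw [h'] at h
        obtain ⟨y, hy, hyj⟩ := h
        have : algebraMap D (Module.End D J) x j = y := Subtype.ext hyj.symm
        rwa [this])
  obtain ⟨j, hjJ, hj0⟩ := Submodule.exists_mem_ne_zero_of_ne_bot hJ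
  rw [Polynomial.aeval_algebraMap_apply] at hp0
  have h0 : Polynomial.aeval x p = 0 := by
    have := congrArg (fun f : Module.End D J => ((f ⟨j, hjJ⟩ : J) : D)) hp0
    simpa [hj0] using this
  rw [Polynomial.aeval_eq_sum_range, Finset.sum_range_succ, hp.coeff_natDegree, one_smul] at h0
  refine ⟨p.natDegree, ?_⟩
  rw [← neg_eq_iff_add_eq_zero] at h0
  rw [← h0]
  refine J.neg_mem (J.sum_mem fun k hk => ?_)
  rw [smul_eq_mul]
  refine J.mul_mem_right _ (Ideal.pow_le_self ?_ (hcoeff k))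
  have := Finset.mem_range.1 hk
  omega

/-- The `q`-power map makes `R` a finite module over itself. -/
def FrobeniusFinite (q : ℕ) (R : Type*) [CommRing R] : Prop :=
  ∃ (k : ℕ) (b : Fin k → R), ∀ r, ∃ s : Fin k → R, r = ∑ i, s i ^ q * b i

theorem FrobeniusFinite.of_surjective {q : ℕ} {R D : Type*} [CommRing R] [CommRing D]
    (h : FrobeniusFinite q R) (f : R →+* D) (hf : Function.Surjective f) :
    FrobeniusFinite q D := by
  obtain ⟨k, b, hb⟩ := h
  refine ⟨k, fun i => f (b i), fun r => ?_⟩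
  obtain ⟨r, rfl⟩ := hf r
  obtain ⟨s, rfl⟩ := hb r
  exact ⟨fun i => f (s i), by simp⟩

/-- A ring regarded as a module over itself through an endomorphism. -/
def EndoModule {D : Type*} [CommRing D] (_ : D →+* D) : Type _ := D

instance {D : Type*} [CommRing D] (φ : D →+* D) : AddCommGroup (EndoModule φ) :=
  inferInstanceAs (AddCommGroup D)

instance {D : Type*} [CommRing D] (φ : D →+* D) : Module D (EndoModule φ) :=
  Module.compHom D φ

theorem EndoModule.smul_def {D : Type*} [CommRing D] (φ : D →+* D) (r : D) (x : EndoModule φ) :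
    r • x = (φ r * (show D from x) : D) := rfl

/-- An `F`-finite domain `D` has a `D ^ q`-linearly independent family whose span contains
`c ^ q D` for some `c ≠ 0`. -/
theorem FrobeniusFinite.exists_independent {q : ℕ} {D : Type*} [CommRing D] [IsDomain D]
    (hD : FrobeniusFinite q D) (φ : D →+* D) (hφ : ∀ r, φ r = r ^ q) :
    ∃ (d : ℕ) (b : Fin d → D), (∀ s : Fin d → D, ∑ i, s i ^ q * b i = 0 → s = 0) ∧
      ∃ c : D, c ≠ 0 ∧ ∀ r, ∃ s : Fin d → D, c ^ q * r = ∑ i, s i ^ q * b i := by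
  have hsum : ∀ {k : ℕ} (s : Fin k → D) (b : Fin k → EndoModule φ),
      ∑ i, s i • b i = (∑ i, s i ^ q * (show D from b i) : D) := by
    intro k s b
    simp only [EndoModule.smul_def, hφ]
    rfl
  have : Module.Finite D (EndoModule φ) := by
    obtain ⟨k, b, hb⟩ := hD
    let b' : Fin k → EndoModule φ := b
    refine Module.Finite.of_surjective (Fintype.linearCombination D b') fun r => ?_
    obtain ⟨s, hs⟩ := hb r
    refine ⟨s, ?_⟩
    rw [Fintype.linearCombination_apply, hsum]
    exact hs.symm
  obtain ⟨b, hb, c, hc, hcb⟩ := Module.exists_linearIndependent_smul_mem_span D (EndoModule φ)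
  refine ⟨_, b, fun s hs => ?_, c, hc, fun r => ?_⟩
  · funext i
    refine Fintype.linearIndependent_iff.1 hb s ?_ i
    rw [hsum]
    exact hs
  · obtain ⟨s, hs⟩ := Submodule.mem_span_range_iff_exists_fun D |>.1 (hcb (show EndoModule φ from r))
    refine ⟨s, ?_⟩
    rw [hsum, EndoModule.smul_def, hφ] at hs
    exact hs.symm

namespace CartierOp

open Module

theorem sum_pow_smul {q : ℕ} {D T ι : Type*} [CommRing D] [AddCommGroup T] [Module D T]
    (C : CartierOp q D T) (s : Finset ι) (a : ι → D) (t : ι → T) :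
    C (∑ i ∈ s, a i ^ q • t i) = ∑ i ∈ s, a i • C (t i) := by
  rw [map_sum]
  exact Finset.sum_congr rfl fun i _ => C.pow_smul _ _

/-- The submodule spanned by an element all whose multiples are killed by `C` is killed
by `C`. -/
theorem eq_zero_of_forall_smul {q : ℕ} {D T : Type*} [CommRing D] [AddCommGroup T] [Module D T]
    (C : CartierOp q D T) (hnil : ∀ N : Submodule D T, C.image N = ⊥ → N = ⊥) {t : T}
    (h : ∀ r : D, C (r • t) = 0) : t = 0 := by
  have : Submodule.span D {t} = ⊥ := by
    refine hnil _ ?_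
    rw [eq_bot_iff, image_le_iff]
    intro x hx
    obtain ⟨r, rfl⟩ := Submodule.mem_span_singleton.1 hx
    exact h r
  rwa [Submodule.span_singleton_eq_bot] at this

/-- Let `T` be a finite torsion-free module over an `F`-finite domain `D`, with a surjective
operator without nilpotents. If all nonzero fixed submodules of `T` have full rank,
then they all contain `c T` for some `c ≠ 0`. -/
theorem exists_smul_mem_of_fixed {q : ℕ} {D T : Type*} [CommRing D] [IsDomain D]
    [IsNoetherianRing D] [AddCommGroup T] [Module D T] [Module.Finite D T]
    (hq : 2 ≤ q) (hD : FrobeniusFinite q D) (φ : D →+* D) (hφ : ∀ r, φ r = r ^ q)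
    (C : CartierOp q D T) (htf : ∀ (r : D) (t : T), r ≠ 0 → r • t = 0 → t = 0)
    (hnil : ∀ N : Submodule D T, C.image N = ⊥ → N = ⊥) (htop : C.image ⊤ = ⊤)
    (hgen : ∀ N : Submodule D T, C.image N = N → N ≠ ⊥ → ∃ r : D, r ≠ 0 ∧ ∀ x, r • x ∈ N) :
    ∃ c : D, c ≠ 0 ∧ ∀ N : Submodule D T, C.image N = N → N ≠ ⊥ → ∀ x, c • x ∈ N := by
  obtain ⟨d, b, hb, c₀, hc₀, hcb⟩ := hD.exists_independent φ hφ
  obtain ⟨e, he⟩ := exists_linearIndependent_of_le_finrank (R := D) (M := T) le_rfl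
  -- the map `m ↦ (C (b k • m))ₖ` has image of full rank
  let K : Submodule D (Fin d → T) :=
    { carrier := Set.range fun m : T => fun k => C (b k • m)
      add_mem' := by
        rintro _ _ ⟨m, rfl⟩ ⟨m', rfl⟩
        exact ⟨m + m', funext fun k => by simp [smul_add]⟩
      zero_mem' := ⟨0, funext fun k => by simp⟩
      smul_mem' := by
        rintro r _ ⟨m, rfl⟩
        refine ⟨r ^ q • m, funext fun k => ?_⟩
        simp only [Pi.smul_apply]
        rw [smul_comm, C.pow_smul] }
  -- Expanding `c₀ ^ q r` in the `b k` gives `c₀ C(r m) = 0` for every `r`. Torsion-freeness removes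
  -- `c₀`, and the absence of nilpotents gives `m = 0`.
  have hinj : ∀ m : T, (∀ k, C (b k • m) = 0) → m = 0 := by
    intro m hm
    refine C.eq_zero_of_forall_smul hnil fun r => htf c₀ _ hc₀ ?_
    obtain ⟨s, hs⟩ := hcb r
    rw [← C.pow_smul, smul_smul, hs, Finset.sum_smul]
    simp only [mul_smul]
    rw [sum_pow_smul]
    exact Finset.sum_eq_zero fun k _ => by rw [hm, smul_zero]
  let v : Fin d × Fin (finrank D T) → K := fun p => ⟨fun k => C (b k • b p.1 • e p.2),
    ⟨b p.1 • e p.2, rfl⟩⟩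
  -- The products `b k • e j` are independent over `q`-th powers, so `K` has rank at least `d` times
  -- that of `T`, which is the rank of `T^d`. Hence `K` contains a multiple `c₁ T^d`.
  have hv : LinearIndependent D v := by
    rw [Fintype.linearIndependent_iff]
    intro g hg
    have h1 : ∑ p : Fin d × Fin (finrank D T), g p ^ q • b p.1 • e p.2 = 0 := by
      refine hinj _ fun k => ?_
      have hgk := congrFun (congrArg Subtype.val hg) k
      simp only [AddSubmonoidClass.coe_finsetSum, Finset.sum_apply, v, Submodule.coe_smul,
        Pi.smul_apply, Submodule.coe_zero, Pi.zero_apply] at hgk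
      rw [Finset.smul_sum, ← hgk, ← sum_pow_smul]
      congr 1
      exact Finset.sum_congr rfl fun p _ => smul_comm _ _ _
    rw [Fintype.sum_prod_type_right] at h1
    have h2 : ∑ j, (∑ k, g (k, j) ^ q * b k) • e j = 0 := by
      rw [← h1]
      refine Finset.sum_congr rfl fun j _ => ?_
      rw [Finset.sum_smul]
      exact Finset.sum_congr rfl fun k _ => mul_smul _ _ _
    have h3 := Fintype.linearIndependent_iff.1 he _ h2
    rintro ⟨k, j⟩
    exact congrFun (hb (fun k => g (k, j)) (h3 j)) k
  have hK : finrank D K = finrank D (Fin d → T) := by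
    refine le_antisymm (Submodule.finrank_le _) ?_
    rw [Module.finrank_fin_fun_of_isDomain]
    simpa using hv.fintype_card_le_finrank
  obtain ⟨c₁, hc₁, hc₁K⟩ := K.exists_smul_mem_of_finrank_eq hK
  refine ⟨c₀ * c₁, mul_ne_zero hc₀ hc₁, fun N hN hN0 => ?_⟩
  -- the radical ideal `(N : T)`
  let J : Ideal D := N.colon (⊤ : Submodule D T)
  have hJ : ∀ {r}, r ∈ J ↔ ∀ x, r • x ∈ N := by
    intro r
    simp [J, Submodule.mem_colon]
  -- Since `T = C(T)`, one has `r T = C(r ^ q T) ⊆ C(N) = N`.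
  have hJrad : ∀ r, r ^ q ∈ J → r ∈ J := by
    intro r hr
    refine hJ.2 fun x => ?_
    obtain ⟨y, -, rfl⟩ : x ∈ C.image ⊤ := by rw [htop]; trivial
    rw [← C.pow_smul, ← hN]
    exact C.apply_mem_image (hJ.1 hr y)
  have hJ0 : J ≠ ⊥ := by
    obtain ⟨r, hr0, hr⟩ := hgen N hN hN0
    exact fun h => hr0 ((Submodule.mem_bot D).1 (h ▸ hJ.2 hr))
  have hmul : ∀ j ∈ J, (c₀ * c₁) ^ q * j ∈ J * J := by
    intro j hj
    obtain ⟨s, hs⟩ := hcb j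
    -- Choose `m` with `C (b k • m) = c₁ x` and `C (b i • m) = 0` for `i ≠ k`. Then `C` extracts the
    -- `k`-th coordinate of `c₀ ^ q j`: `c₀ C(j m) = c₁ s_k x`, and `j m ∈ N`. Consequently `(c₀ c₁)
    -- ^ q j` is a combination of `q`-th powers of elements of `J`, so it lies in `J²`.
    have hsJ : ∀ k, c₁ * s k ∈ J := by
      intro k
      refine hJ.2 fun x => ?_
      obtain ⟨m, hm⟩ := hc₁K (Pi.single k x)
      have h1 : c₀ • C (j • m) = (c₁ * s k) • x := by
        rw [← C.pow_smul, smul_smul, hs, Finset.sum_smul]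
        simp only [mul_smul]
        rw [sum_pow_smul, Finset.sum_eq_single k]
        · have := congrFun hm k
          simp only [Pi.smul_apply, Pi.single_eq_same] at this
          rw [this, smul_comm]
        · intro i _ hik
          have := congrFun hm i
          simp only [Pi.smul_apply, Pi.single_eq_of_ne hik, smul_zero] at this
          rw [this, smul_zero]
        · simp
      rw [← h1]
      exact N.smul_mem _ (hN ▸ C.apply_mem_image (hJ.1 hj m))
    have h2 : (c₀ * c₁) ^ q * j = ∑ k, (c₁ * s k) ^ q * b k := by
      rw [mul_pow, mul_assoc, mul_left_comm, hs, Finset.mul_sum]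
      exact Finset.sum_congr rfl fun k _ => by rw [mul_pow, mul_assoc]
    rw [h2, ← sq]
    exact Ideal.sum_mem _ fun k _ => Ideal.mul_mem_right _ _
      (Ideal.pow_le_pow_right hq (Ideal.pow_mem_pow (hsJ k) q))
  obtain ⟨n, hn⟩ := Ideal.exists_pow_mem_of_mul_mem_mul hJ0 hmul
  have hpow : ∀ m r, r ^ q ^ m ∈ J → r ∈ J := by
    intro m
    induction m with
    | zero => intro r hr; simpa using hr
    | succ m ih => intro r hr; exact hJrad r (ih _ (by rwa [← pow_mul, ← pow_succ']))
  -- The exponent `n` depends on `N`. It is enlarged to `q ^ n`, and taking `q`-th roots in `J` then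
  -- eliminates it, leaving the uniform `c₀ c₁`.
  refine hJ.1 (hJrad _ (hpow n _ ?_))
  exact Ideal.pow_mem_of_pow_mem _ hn (Nat.lt_pow_self (by omega)).le

/-! ### Finiteness of equivariant maps. -/

/-- There are only finitely many equivariant maps from a finite module with surjective operator to
a finite torsion-free module over a quotient domain with operator without nilpotents. -/
theorem finite_equivariant {q : ℕ} {R D N T : Type*} [CommRing R] [CommRing D] [IsDomain D]
    [IsNoetherianRing D] [Algebra R D] (hRD : Function.Surjective (algebraMap R D))
    [AddCommGroup N] [Module R N] [Module.Finite R N]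
    [AddCommGroup T] [Module R T] [Module D T] [IsScalarTower R D T] [Module.Finite D T]
    (hq : 2 ≤ q) (CN : CartierOp q R N) (htop : CN.image ⊤ = ⊤)
    (C : CartierOp q D T) (htf : ∀ (r : D) (t : T), r ≠ 0 → r • t = 0 → t = 0)
    (hnil : ∀ N : Submodule D T, C.image N = ⊥ → N = ⊥) :
    {h : N →ₗ[R] T | ∀ x, h (CN x) = C (h x)}.Finite := by
  have : IsNoetherian D T := isNoetherian_of_isNoetherianRing_of_finite _ _
  set H := {h : N →ₗ[R] T | ∀ x, h (CN x) = C (h x)}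
  have hnoeth : IsNoetherian D (N →ₗ[R] T) := by
    obtain ⟨k, s, hs⟩ := Module.Finite.exists_fin (R := R) (M := N)
    let f : (N →ₗ[R] T) →ₗ[D] (Fin k → T) :=
      { toFun := fun h i => h (s i)
        map_add' := fun _ _ => rfl
        map_smul' := fun _ _ => rfl }
    refine isNoetherian_of_injective f fun h h' hh => ?_
    refine LinearMap.ext_on_range hs fun i => congrFun hh i
  -- a relation between equivariant maps is preserved by raising the coefficients to the `q`
  have hrel : ∀ {ι : Type _} [Fintype ι] (h₀ : H) (h : ι → H) (a₀ : D) (a : ι → D),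
      a₀ • (h₀ : N →ₗ[R] T) = ∑ i, a i • (h i : N →ₗ[R] T) →
      a₀ ^ q • (h₀ : N →ₗ[R] T) = ∑ i, a i ^ q • (h i : N →ₗ[R] T) := by
    intro ι _ h₀ h a₀ a ha
    -- For each `r`, applying `C` to `r` times the difference at `x` gives the original relation
    -- evaluated at `CN (r • x)`, which vanishes.
    refine LinearMap.ext fun x => sub_eq_zero.1 (C.eq_zero_of_forall_smul hnil fun r => ?_)
    obtain ⟨r, rfl⟩ := hRD r
    rw [algebraMap_smul, smul_sub, ← map_smul, ← map_smul, LinearMap.sum_apply, map_sub]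
    simp only [LinearMap.smul_apply]
    rw [sum_pow_smul, C.pow_smul, sub_eq_zero]
    have := LinearMap.congr_fun ha (CN (r • x))
    rw [LinearMap.sum_apply] at this
    simp only [LinearMap.smul_apply] at this
    rw [h₀.2] at this
    rw [this]
    exact Finset.sum_congr rfl fun i _ => by rw [(h i).2]
  have htf' : ∀ (r : D) (h : N →ₗ[R] T), r ≠ 0 → r • h = 0 → h = 0 := fun r h hr hh =>
    LinearMap.ext fun x => htf r _ hr (LinearMap.congr_fun hh x)
  obtain ⟨s, hs, hmax⟩ := exists_maximal_linearIndepOn D (fun h : H => (h : N →ₗ[R] T))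
  have : Finite s := hs.finite_of_isNoetherian
  have := Fintype.ofFinite s
  have hex : ∀ h : H, ∃ (a : D) (c : s → D), a ≠ 0 ∧
      a • (h : N →ₗ[R] T) = ∑ i, c i • (i.1 : N →ₗ[R] T) ∧ ∀ i, a ^ (q - 1) * c i = c i ^ q := by
    intro h
    obtain ⟨a, ha, hspan⟩ : ∃ a : D, a ≠ 0 ∧ a • (h : N →ₗ[R] T) ∈
        Submodule.span D (Set.range fun i : s => (i.1 : N →ₗ[R] T)) := by
      by_cases hhs : h ∈ s
      · exact ⟨1, one_ne_zero, Submodule.smul_mem _ _ (Submodule.subset_span ⟨⟨h, hhs⟩, rfl⟩)⟩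
      · obtain ⟨a, ha, h'⟩ := hmax h hhs
        exact ⟨a, ha, by rwa [Set.image_eq_range] at h'⟩
    obtain ⟨c, hc⟩ := (Submodule.mem_span_range_iff_exists_fun D).1 hspan
    refine ⟨a, c, ha, hc.symm, ?_⟩
    -- Compares `a ^ (q - 1)` times the relation with the relation with `q`-th power coefficients.
    -- By independence, each `c i / a` is a root of `X ^ q - X`.
    have h2 : ∑ i : s, (a ^ (q - 1) * c i - c i ^ q) • (i.1 : N →ₗ[R] T) = 0 := by
      simp only [sub_smul, mul_smul, Finset.sum_sub_distrib, ← Finset.smul_sum, hc]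
      rw [← hrel h (fun i : s => i.1) a c hc.symm, smul_smul, ← pow_succ,
        Nat.sub_add_cancel (by omega), sub_self]
    intro i
    exact sub_eq_zero.1 (Fintype.linearIndependent_iff.1 hs _ h2 i)
  choose a c ha hac hroot using hex
  let K := FractionRing D
  have hinj : Function.Injective fun (h : H) (i : s) =>
      (algebraMap D K (c h i) / algebraMap D K (a h)) := by
    intro h h' hh
    have hne : ∀ h, algebraMap D K (a h) ≠ 0 := fun h =>
      IsFractionRing.to_map_ne_zero_of_mem_nonZeroDivisors (mem_nonZeroDivisors_of_ne_zero (ha h))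
    have h1 : ∀ i, a h' * c h i = a h * c h' i := by
      intro i
      have := congrFun hh i
      simp only at this
      rw [div_eq_div_iff (hne _) (hne _), ← map_mul, ← map_mul] at this
      have := IsFractionRing.injective D K this
      rw [mul_comm, this, mul_comm]
    refine Subtype.ext (sub_eq_zero.1 (htf' (a h * a h') _ (mul_ne_zero (ha _) (ha _)) ?_))
    rw [smul_sub, mul_comm, mul_smul, hac, mul_comm, mul_smul, hac, Finset.smul_sum,
      Finset.smul_sum, sub_eq_zero]
    exact Finset.sum_congr rfl fun i _ => by rw [smul_smul, smul_smul, h1]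
  have hfin : {x : K | x ^ q = x}.Finite := by
    have hpoly : (Polynomial.X ^ q - Polynomial.X : Polynomial K) ≠ 0 :=
      FiniteField.X_pow_card_sub_X_ne_zero K (by omega)
    refine (Polynomial.finite_setOfPred_isRoot hpoly).subset fun x hx => ?_
    simpa [Polynomial.IsRoot, sub_eq_zero] using hx
  have hmaps : ∀ (h : H) (i : s), algebraMap D K (c h i) / algebraMap D K (a h) ∈
      {x : K | x ^ q = x} := by
    intro h i
    have hne : algebraMap D K (a h) ≠ 0 :=
      IsFractionRing.to_map_ne_zero_of_mem_nonZeroDivisors (mem_nonZeroDivisors_of_ne_zero (ha h))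
    change _ ^ q = _
    rw [div_pow, ← map_pow (algebraMap D K) (c h i), ← hroot, div_eq_div_iff (pow_ne_zero _ hne) hne,
      map_mul, map_pow]
    obtain ⟨n, rfl⟩ : ∃ n, q = n + 1 := ⟨q - 1, by omega⟩
    rw [Nat.add_sub_cancel]
    ring
  have : Finite {x : K | x ^ q = x} := hfin
  rw [← Set.finite_coe_iff]
  refine Finite.of_injective (fun (h : H) (i : s) =>
    (⟨_, hmaps h i⟩ : {x : K | x ^ q = x})) fun h h' hh => hinj ?_
  funext i
  exact congrArg Subtype.val (congrFun hh i)

end CartierOp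

/-! ### Finiteness of fixed submodules over an affine base. -/

namespace CartierOp

open Module

/-- The fixed submodules meeting a given stable submodule `T` trivially and with the same sum
with `T` as `N₀` are graphs of equivariant maps `N₀ → T`. -/
theorem exists_equivariant_range_eq {q : ℕ} {R M : Type*} [CommRing R] [AddCommGroup M]
    [Module R M] (C : CartierOp q R M) {T N₀ N : Submodule R M} (hT : C.image T ≤ T)
    (hN₀ : C.image N₀ ≤ N₀) (hN : C.image N ≤ N) (hNT : N ⊓ T = ⊥)
    (h : N ⊔ T = N₀ ⊔ T) :
    ∃ f : N₀ →ₗ[R] T, (∀ x, f (C.restrict N₀ hN₀ x) = C.restrict T hT (f x)) ∧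
      LinearMap.range (N₀.subtype + T.subtype ∘ₗ f) = N := by
  have huniq : ∀ t ∈ T, ∀ t' ∈ T, ∀ x, x + t ∈ N → x + t' ∈ N → t = t' := by
    intro t ht t' ht' x hx hx'
    have h1 : t - t' ∈ N ⊓ T := ⟨by simpa using N.sub_mem hx hx', T.sub_mem ht ht'⟩
    rw [hNT, Submodule.mem_bot] at h1
    exact sub_eq_zero.1 h1
  have hex : ∀ x : N₀, ∃ t : T, (x + t : M) ∈ N := by
    intro x
    obtain ⟨n, hn, t, ht, hnt⟩ := Submodule.mem_sup.1 (h ▸ Submodule.mem_sup_left x.2 :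
      (x : M) ∈ N ⊔ T)
    exact ⟨-⟨t, ht⟩, by simpa [← hnt] using hn⟩
  choose f hf using hex
  let F : N₀ →ₗ[R] T :=
    { toFun := f
      map_add' := fun x y => Subtype.ext (huniq _ (f (x + y)).2 _ (f x + f y).2 (x + y : N₀) (hf _)
        (by
          have := N.add_mem (hf x) (hf y)
          rw [Submodule.coe_add, Submodule.coe_add]
          rwa [add_add_add_comm] at this))
      map_smul' := fun r x => Subtype.ext (huniq _ (f (r • x)).2 _ (r • f x).2 (r • x : N₀) (hf _)
        (by
          have := N.smul_mem r (hf x)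
          rw [Submodule.coe_smul, RingHom.id_apply, Submodule.coe_smul]
          rwa [smul_add] at this)) }
  refine ⟨F, fun x => Subtype.ext (huniq _ (f _).2 _ (C.restrict T hT (f x)).2
    (C.restrict N₀ hN₀ x : N₀) (hf _) ?_), ?_⟩
  · have := hN (C.apply_mem_image (hf x))
    rwa [map_add] at this
  · apply le_antisymm
    · rintro _ ⟨x, rfl⟩
      exact hf x
    · intro n hn
      obtain ⟨x, hx, t, ht, hxt⟩ := Submodule.mem_sup.1 (h ▸ Submodule.mem_sup_left hn :
        n ∈ N₀ ⊔ T)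
      refine ⟨⟨x, hx⟩, ?_⟩
      change x + (f ⟨x, hx⟩ : M) = n
      rw [← hxt, huniq _ (f ⟨x, hx⟩).2 t ht x (hf ⟨x, hx⟩) (hxt ▸ hn)]

theorem finite_fixed_ge {q : ℕ} {R M : Type*} [CommRing R] [AddCommGroup M] [Module R M]
    (C : CartierOp q R M) {L : Submodule R M} (hL : C.image L ≤ L)
    (hfin : {N | (C.quot L hL).image N = N}.Finite) :
    {N | C.image N = N ∧ L ≤ N}.Finite := by
  refine Set.Finite.of_injOn (f := Submodule.map L.mkQ) ?_ ?_ hfin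
  · rintro N ⟨hN, -⟩
    change (C.quot L hL).image _ = _
    rw [quot_image_map, hN]
  · rintro N ⟨-, hN⟩ N' ⟨-, hN'⟩ h
    have := congrArg (Submodule.comap L.mkQ) h
    rwa [Submodule.comap_map_mkQ, Submodule.comap_map_mkQ, sup_eq_right.2 hN,
      sup_eq_right.2 hN'] at this

/-- Since `C(L) = 0`, a fixed `N` equals `C(N + L)` and is recovered from its image in `M/L`. -/
theorem finite_fixed_of_image_eq_bot {q : ℕ} {R M : Type*} [CommRing R] [AddCommGroup M]
    [Module R M] (C : CartierOp q R M) {L : Submodule R M} (hL : C.image L ≤ L)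
    (hL0 : C.image L = ⊥) (hfin : {N | (C.quot L hL).image N = N}.Finite) :
    {N | C.image N = N}.Finite := by
  refine Set.Finite.of_injOn (f := Submodule.map L.mkQ) ?_ ?_ hfin
  · intro N hN
    change (C.quot L hL).image _ = _
    rw [quot_image_map, hN]
  · intro N hN N' hN' h
    have := congrArg C.image (congrArg (Submodule.comap L.mkQ) h)
    rwa [Submodule.comap_map_mkQ, Submodule.comap_map_mkQ, image_sup, image_sup, hL0, bot_sup_eq,
      bot_sup_eq, hN, hN'] at this

/-- The images in `M/T` form a finite set. Members with the same image as a chosen `N₀` are graphs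
of equivariant maps `N₀ → T`, so each fibre is finite by `finite_equivariant`. -/
theorem finite_fixed_inf_eq_bot {q : ℕ} {R M : Type*} [CommRing R] [IsNoetherianRing R]
    [AddCommGroup M] [Module R M] [Module.Finite R M] (hq : 2 ≤ q)
    (C : CartierOp q R M) (hnil : ∀ N : Submodule R M, C.image N = ⊥ → N = ⊥)
    {T : Submodule R M} (hT : C.image T ≤ T) {P : Ideal R} (hP : P.IsPrime)
    (hPT : ∀ r ∈ P, ∀ t ∈ T, r • t = 0) (htf : ∀ r ∉ P, ∀ t ∈ T, r • t = 0 → t = 0)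
    (hfin : {N | (C.quot T hT).image N = N}.Finite) :
    {N | C.image N = N ∧ N ⊓ T = ⊥}.Finite := by
  have htors : Module.IsTorsionBySet R T P := fun t r => Subtype.ext (hPT r r.2 t t.2)
  let : Module (R ⧸ P) T := htors.module
  have : IsScalarTower R (R ⧸ P) T := htors.isScalarTower
  have : Module.Finite (R ⧸ P) T := Module.Finite.of_restrictScalars_finite R (R ⧸ P) T
  let CD : CartierOp q (R ⧸ P) T :=
    { toAddMonoidHom := (C.restrict T hT).toAddMonoidHom
      pow_smul' := by
        intro r t
        obtain ⟨r, rfl⟩ := Ideal.Quotient.mk_surjective r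
        exact (C.restrict T hT).pow_smul r t }
  have hCDnil : ∀ N : Submodule (R ⧸ P) T, CD.image N = ⊥ → N = ⊥ := by
    intro N hN
    have h1 : C.image ((N.restrictScalars R).map T.subtype) = ⊥ := by
      rw [eq_bot_iff, image_le_iff]
      rintro _ ⟨x, hx, rfl⟩
      have h2 : CD x ∈ (⊥ : Submodule (R ⧸ P) T) := hN ▸ CD.apply_mem_image hx
      rw [Submodule.mem_bot] at h2
      exact congrArg Subtype.val h2
    rw [eq_bot_iff]
    intro x hx
    have h2 : (x : M) ∈ (N.restrictScalars R).map T.subtype := ⟨x, hx, rfl⟩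
    rw [hnil _ h1, Submodule.mem_bot] at h2
    exact Subtype.ext h2
  have htf' : ∀ (r : R ⧸ P) (t : T), r ≠ 0 → r • t = 0 → t = 0 := by
    intro r t hr h
    obtain ⟨r, rfl⟩ := Ideal.Quotient.mk_surjective r
    refine Subtype.ext (htf r (fun h' => hr (Ideal.Quotient.eq_zero_iff_mem.2 h')) t t.2 ?_)
    exact congrArg Subtype.val h
  refine Set.Finite.of_finite_fibers (Submodule.map T.mkQ) (hfin.subset ?_) ?_
  · rintro _ ⟨N, ⟨hN, -⟩, rfl⟩
    change (C.quot T hT).image _ = _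
    rw [quot_image_map, hN]
  · rintro _ ⟨N₀, ⟨hN₀, -⟩, rfl⟩
    have htop : (C.restrict N₀ hN₀.le).image ⊤ = ⊤ := by
      apply Submodule.map_injective_of_injective N₀.injective_subtype
      rw [restrict_image_map, Submodule.map_top, Submodule.range_subtype, hN₀]
    refine ((finite_equivariant (D := R ⧸ P) Ideal.Quotient.mk_surjective hq
      (C.restrict N₀ hN₀.le) htop CD htf' hCDnil).image
      fun f => LinearMap.range (N₀.subtype + T.subtype ∘ₗ f)).subset ?_
    rintro N ⟨⟨hN, hNT⟩, h⟩
    have h' := congrArg (Submodule.comap T.mkQ) h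
    rw [Submodule.comap_map_mkQ, Submodule.comap_map_mkQ, sup_comm, sup_comm T] at h'
    obtain ⟨f, hf, hfN⟩ := C.exists_equivariant_range_eq hT hN₀.le hN.le hNT h'
    exact ⟨f, hf, hfN⟩

/-- A finite module with operator over an `F`-finite Noetherian ring has only finitely many
submodules `N` with `C(N) = N`. -/
theorem finite_fixed {q : ℕ} {R : Type*} [CommRing R] [IsNoetherianRing R] (hq : 2 ≤ q)
    (hR : FrobeniusFinite q R) (φ : R →+* R) (hφ : ∀ r, φ r = r ^ q)
    (M : Type u) [AddCommGroup M] [Module R M] [Module.Finite R M] (C : CartierOp q R M) :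
    {N | C.image N = N}.Finite := by
  refine CartierOp.quotient_induction
    (P := fun M _ _ C => {N | C.image N = N}.Finite) ?_ M C
  intro M _ _ _ C ih
  have hq0 : q ≠ 0 := by omega
  rcases subsingleton_or_nontrivial M with hM | hM
  · exact Set.toFinite _
  by_cases hnil : ∀ N : Submodule R M, C.image N = ⊥ → N = ⊥
  swap
  · push Not at hnil
    obtain ⟨L, hL, hL0⟩ := hnil
    have hL' : C.image L ≤ L := hL ▸ bot_le
    exact C.finite_fixed_of_image_eq_bot hL' hL (ih L hL' hL0)
  obtain ⟨P, T, hP, hTle, hT, hT0, hPT, htf, hmin⟩ : ∃ (P : Ideal R) (T : Submodule R M),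
      P.IsPrime ∧ C.image T ≤ T ∧ C.image T = T ∧ T ≠ ⊥ ∧
      (∀ r ∈ P, ∀ t ∈ T, r • t = 0) ∧ (∀ r ∉ P, ∀ t ∈ T, r • t = 0 → t = 0) ∧
      ∀ N ≤ T, C.image N ≤ N → N ≠ ⊥ → ∃ r ∉ P, ∀ x ∈ T, r • x ∈ N := by
    -- Replacing `T` by its stable value makes it fixed. It stays nonzero for lack of nilpotents,
    -- and the other properties pass to submodules.
    obtain ⟨P, T, hP, hT, hT0, hPT, htf, hmin⟩ := C.exists_generically_minimal hq0
    obtain ⟨e, he⟩ := C.exists_iterate_image_eq hq hT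
    have hle := C.iterate_image_le hT e
    rw [Function.iterate_succ_apply'] at he
    exact ⟨P, _, hP, he.le, he, C.iterate_image_ne_bot hnil hT0 e,
      fun r hr t ht => hPT r hr t (hle ht), fun r hr t ht => htf r hr t (hle ht),
      fun N hN hNC hN0 => (hmin N (hN.trans hle) hNC hN0).imp
        fun r hr => ⟨hr.1, fun x hx => hr.2 x (hle hx)⟩⟩
  -- `L` need not be fixed, but stability is enough to form `M/L`.
  let L : Submodule R M := sInf {N | C.image N = N ∧ N ≠ ⊥ ∧ N ≤ T}
  have hL : C.image L ≤ L := le_sInf fun N hN => by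
    rw [← hN.1]
    exact C.image_mono (sInf_le hN)
  have hL0 : L ≠ ⊥ := by
    have htors : Module.IsTorsionBySet R T P := fun t r => Subtype.ext (hPT r r.2 t t.2)
    let : Module (R ⧸ P) T := htors.module
    have : IsScalarTower R (R ⧸ P) T := htors.isScalarTower
    have : Module.Finite (R ⧸ P) T := Module.Finite.of_restrictScalars_finite R (R ⧸ P) T
    let CD : CartierOp q (R ⧸ P) T :=
      { toAddMonoidHom := (C.restrict T hTle).toAddMonoidHom
        pow_smul' := by
          intro r t
          obtain ⟨r, rfl⟩ := Ideal.Quotient.mk_surjective r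
          exact (C.restrict T hTle).pow_smul r t }
    let ι : Submodule (R ⧸ P) T → Submodule R M := fun N => (N.restrictScalars R).map T.subtype
    have hι : ∀ N, C.image (ι N) = ι (CD.image N) := fun N =>
      ((C.restrict_image_map hTle (N.restrictScalars R))).symm
    have hι0 : ∀ N, ι N = ⊥ → N = ⊥ := by
      intro N hN
      rw [eq_bot_iff]
      intro x hx
      have h2 : (x : M) ∈ ι N := ⟨x, hx, rfl⟩
      rw [hN, Submodule.mem_bot] at h2
      exact Subtype.ext h2
    have hιT : ∀ N, ι N ≤ T := by
      rintro N _ ⟨x, -, rfl⟩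
      exact x.2
    let φD : R ⧸ P →+* R ⧸ P := Ideal.quotientMap P φ fun r hr => by
      rw [Ideal.mem_comap, hφ]
      exact P.pow_mem_of_mem hr q (by omega)
    -- The uniform `c` puts `c T` into `L`. As `T` is torsion-free over `R ⧸ P`, this forces `L ≠
    -- 0`.
    obtain ⟨c, hc0, hc⟩ := CD.exists_smul_mem_of_fixed hq
      (hR.of_surjective (Ideal.Quotient.mk P) Ideal.Quotient.mk_surjective) φD
      (by
        intro r
        obtain ⟨r, rfl⟩ := Ideal.Quotient.mk_surjective r
        rw [Ideal.quotientMap_mk, hφ, map_pow])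
      (by
        intro r t hr h
        obtain ⟨r, rfl⟩ := Ideal.Quotient.mk_surjective r
        exact Subtype.ext (htf r (fun h' => hr (Ideal.Quotient.eq_zero_iff_mem.2 h')) t t.2
          (congrArg Subtype.val h)))
      (fun N hN => hι0 N (hnil _ (by rw [hι, hN]; simp [ι])))
      (by
        refine eq_top_iff.2 fun t _ => ?_
        obtain ⟨y, hy, hyt⟩ := hT.ge t.2
        exact ⟨⟨y, hy⟩, trivial, Subtype.ext hyt⟩)
      (by
        intro N hN hN0
        obtain ⟨r, hr, hrN⟩ := hmin (ι N) (hιT N) (by rw [hι, hN]) fun h => hN0 (hι0 N h)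
        refine ⟨Ideal.Quotient.mk P r, fun h => hr (Ideal.Quotient.eq_zero_iff_mem.1 h),
          fun x => ?_⟩
        obtain ⟨y, hy, hyx⟩ := hrN x x.2
        have : y = r • x := Subtype.ext hyx
        exact this ▸ hy)
    obtain ⟨c, rfl⟩ := Ideal.Quotient.mk_surjective c
    obtain ⟨t, htT, ht0⟩ := Submodule.exists_mem_ne_zero_of_ne_bot hT0
    have hct : c • t ∈ L := by
      rw [Submodule.mem_sInf]
      rintro N ⟨hN, hN0, hNT⟩
      let gN : Submodule (R ⧸ P) T :=
        { carrier := {u | (u : M) ∈ N}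
          add_mem' := fun ha hb => N.add_mem ha hb
          zero_mem' := N.zero_mem
          smul_mem' := by
            intro c u hu
            obtain ⟨c, rfl⟩ := Ideal.Quotient.mk_surjective c
            exact N.smul_mem c hu }
      refine hc gN ?_ ?_ ⟨t, htT⟩
      · ext x
        constructor
        · rintro ⟨y, hy, rfl⟩
          exact hN.le (C.apply_mem_image hy)
        · intro hx
          obtain ⟨y, hy, hyx⟩ := hN.ge hx
          exact ⟨⟨y, hNT hy⟩, hy, Subtype.ext hyx⟩
      · intro h
        obtain ⟨n, hn, hn0⟩ := Submodule.exists_mem_ne_zero_of_ne_bot hN0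
        have h' : (⟨n, hNT hn⟩ : T) ∈ gN := hn
        rw [h, Submodule.mem_bot] at h'
        exact hn0 (congrArg Subtype.val h')
    intro h
    rw [h, Submodule.mem_bot] at hct
    exact ht0 (htf c (fun h' => hc0 (Ideal.Quotient.eq_zero_iff_mem.2 h')) t htT hct)
  refine ((C.finite_fixed_ge hL (ih L hL hL0)).union
    (C.finite_fixed_inf_eq_bot hq hnil hTle hP hPT htf (ih T hTle hT0))).subset ?_
  intro N hN
  by_cases hNT : N ⊓ T = ⊥
  · exact Or.inr ⟨hN, hNT⟩
  refine Or.inl ⟨hN, ?_⟩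
  have hle : C.image (N ⊓ T) ≤ N ⊓ T :=
    le_inf ((C.image_mono inf_le_left).trans hN.le) ((C.image_mono inf_le_right).trans hTle)
  -- `N ⊓ T` is only stable. Its stable value is a nonzero fixed submodule of `T`, so it contains
  -- `L`.
  obtain ⟨e, he⟩ := C.exists_iterate_image_eq hq hle
  rw [Function.iterate_succ_apply'] at he
  have := C.iterate_image_le hle e
  have hmem : C.image^[e] (N ⊓ T) ∈ {N | C.image N = N ∧ N ≠ ⊥ ∧ N ≤ T} :=
    ⟨he, C.iterate_image_ne_bot hnil hNT e, this.trans inf_le_right⟩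
  exact (sInf_le hmem).trans (this.trans inf_le_left)

end CartierOp

/-! ### Quasi-coherence tested on sections over affine opens. -/

/-- Transport of a presentation along an isomorphism. -/
noncomputable def SheafOfModules.Presentation.ofIso {C : Type*} [Category C]
    {J : GrothendieckTopology C} {R : Sheaf J RingCat.{u}} [HasSheafify J AddCommGrpCat.{u}]
    [J.WEqualsLocallyBijective AddCommGrpCat.{u}] {M N : SheafOfModules.{u} R}
    (e : M ≅ N) (P : M.Presentation) : N.Presentation :=
  P.ofIsIso e.hom

namespace AlgebraicGeometry.Scheme.Modules
open TopologicalSpace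
variable {X : Scheme.{u}}

/-- Restriction of functions. -/
def resFun (X : Scheme.{u}) {U V : X.Opens} (h : V ≤ U) : Γ(X, U) →+* Γ(X, V) :=
  (X.presheaf.map (homOfLE h).op).hom

/-- Restriction of sections. -/
noncomputable def res (M : X.Modules) {U V : X.Opens} (h : V ≤ U) : Γ(M, U) →+ Γ(M, V) :=
  (M.presheaf.map (homOfLE h).op).hom

theorem res_smul (M : X.Modules) {U V : X.Opens} (h : V ≤ U) (r : Γ(X, U)) (x : Γ(M, U)) :
    M.res h (r • x) = resFun X h r • M.res h x := M.map_smul (homOfLE h) r x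

theorem res_res (M : X.Modules) {U V W : X.Opens} (h : V ≤ U) (h' : W ≤ V) (x : Γ(M, U)) :
    M.res h' (M.res h x) = M.res (h'.trans h) x := by
  unfold res
  rw [← AddCommGrpCat.comp_apply, ← M.presheaf.map_comp]
  rfl

theorem res_self (M : X.Modules) {U : X.Opens} (h : U ≤ U) (x : Γ(M, U)) :
    M.res h x = x := by
  unfold res
  have : homOfLE h = 𝟙 U := rfl
  rw [this, op_id, M.presheaf.map_id]
  rfl

theorem resFun_resFun {U V W : X.Opens} (h : V ≤ U) (h' : W ≤ V) (x : Γ(X, U)) :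
    resFun X h' (resFun X h x) = resFun X (h'.trans h) x := by
  unfold resFun
  rw [← CommRingCat.comp_apply, ← X.presheaf.map_comp]
  rfl

theorem app_res {M N : X.Modules} (φ : M ⟶ N) {U V : X.Opens} (h : V ≤ U) (x : Γ(M, U)) :
    φ.app V (M.res h x) = N.res h (φ.app U x) :=
  congr($(φ.mapPresheaf.naturality (homOfLE h).op) x)

theorem eq_of_res_eq (M : X.Modules) {ι : Type*} {U : X.Opens} (V : ι → X.Opens)
    (hV : ∀ i, V i ≤ U) (hcov : U ≤ ⨆ i, V i) {s t : Γ(M, U)}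
    (h : ∀ i, M.res (hV i) s = M.res (hV i) t) : s = t :=
  TopCat.Sheaf.eq_of_locally_eq' ⟨_, M.isSheaf⟩ V U (fun i => homOfLE (hV i)) hcov s t h

theorem exists_res_eq (M : X.Modules) {ι : Type u} {U : X.Opens} (V : ι → X.Opens)
    (hV : ∀ i, V i ≤ U) (hcov : U ≤ ⨆ i, V i) (s : ∀ i, Γ(M, V i))
    (h : ∀ i j, M.res (inf_le_left : V i ⊓ V j ≤ V i) (s i) =
      M.res (inf_le_right : V i ⊓ V j ≤ V j) (s j)) :
    ∃ t : Γ(M, U), ∀ i, M.res (hV i) t = s i := by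
  obtain ⟨t, ht, -⟩ := TopCat.Sheaf.existsUnique_gluing' ⟨_, M.isSheaf⟩ V U
    (fun i => homOfLE (hV i)) hcov s h
  exact ⟨t, ht⟩

/-- The restriction map `Γ(M, U) → Γ(M, W)` has the properties of a localization at `f`. -/
structure LocalizesAt (M : X.Modules) {U W : X.Opens} (h : W ≤ U) (f : Γ(X, U)) : Prop where
  exists_res : ∀ s : Γ(M, W), ∃ (n : ℕ) (t : Γ(M, U)), M.res h t = resFun X h f ^ n • s
  exists_pow_smul : ∀ t : Γ(M, U), M.res h t = 0 → ∃ n : ℕ, f ^ n • t = 0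

/-- Sections of `M` over the basic opens of `U` are localizations of the sections over `U`. -/
def Localizes (M : X.Modules) (U : X.Opens) : Prop :=
  ∀ f : Γ(X, U), M.LocalizesAt (X.basicOpen_le f) f

theorem LocalizesAt.congr {M : X.Modules} {U W U' W' : X.Opens} {h : W ≤ U} {h' : W' ≤ U'}
    {f : Γ(X, U)} (hU : U = U') (hW : W = W')
    (H : M.LocalizesAt h' (resFun X hU.ge f)) : M.LocalizesAt h f := by
  subst hU hW
  have : resFun X (le_refl U) f = f := by
    unfold resFun
    have : homOfLE (le_refl U) = 𝟙 U := rfl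
    rw [this, op_id, X.presheaf.map_id]
    rfl
  rwa [this] at H

theorem LocalizesAt.congr' {M : X.Modules} {U W U' W' : X.Opens} {h : W ≤ U} {h' : W' ≤ U'}
    {f : Γ(X, U)} (hU : U = U') (hW : W = W')
    (H : M.LocalizesAt h f) : M.LocalizesAt h' (resFun X hU.ge f) := by
  subst hU hW
  have : resFun X (le_refl U) f = f := by
    unfold resFun
    have : homOfLE (le_refl U) = 𝟙 U := rfl
    rw [this, op_id, X.presheaf.map_id]
    rfl
  rwa [this]

theorem fromSpec_smul {U : X.Opens} (hU : IsAffineOpen U) (M : X.Modules)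
    (V : (Spec Γ(X, U)).Opens) (hV : hU.fromSpec ''ᵁ V ≤ U) (f : Γ(X, U))
    (x : Γ(M, hU.fromSpec ''ᵁ V)) :
    f • (show Γ(M.restrict hU.fromSpec, V) from x) = resFun X hV f • x := by
  rw [smul_Spec_def]
  change ((hU.fromSpec.appIso V).inv _) • x = _
  congr 1
  have : (Scheme.ΓSpecIso Γ(X, U)).inv ≫ (Spec Γ(X, U)).presheaf.map V.leTop.op ≫
      (hU.fromSpec.appIso V).inv = X.presheaf.map (homOfLE hV).op := by
    have h1 : (Scheme.ΓSpecIso Γ(X, U)).inv = hU.fromSpec.app U ≫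
        (Spec Γ(X, U)).presheaf.map (eqToHom hU.fromSpec_preimage_self.symm).op := by
      rw [hU.fromSpec_app_self, Category.assoc, ← Functor.map_comp, ← op_comp, eqToHom_trans]
      simp
    rw [h1, Category.assoc, ← Functor.map_comp_assoc]
    have h2 : V ≤ hU.fromSpec ⁻¹ᵁ U := by rw [hU.fromSpec_preimage_self]; exact le_top
    have h3 : (eqToHom hU.fromSpec_preimage_self.symm).op ≫ V.leTop.op = (homOfLE h2).op := rfl
    rw [h3]
    have := Scheme.Hom.appIso_inv_naturality hU.fromSpec (homOfLE h2).op
    rw [this, Scheme.Hom.app_appIso_inv_assoc]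
    exact (X.presheaf.map_comp _ _).symm
  exact congr($this f)

/-- Both sides say that sections over `D(f)` are the localization at `f`. The work lies in matching
opens of `U` with opens of `Spec Γ(X, U)`, and the two scalar actions via `fromSpec_smul`. -/
theorem localizes_iff_isIso_fromTildeΓ {U : X.Opens} (hU : IsAffineOpen U) (M : X.Modules) :
    M.Localizes U ↔ IsIso (M.restrict hU.fromSpec).fromTildeΓ := by
  rw [isIso_fromTildeΓ_iff_isLocalizing]
  have htop : hU.fromSpec ''ᵁ ⊤ = U := by
    rw [Scheme.Hom.image_top_eq_opensRange, hU.opensRange_fromSpec]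
  have hbas : ∀ f : Γ(X, U), hU.fromSpec ''ᵁ (PrimeSpectrum.basicOpen f) = X.basicOpen f :=
    hU.fromSpec_image_basicOpen
  have hle : ∀ f : Γ(X, U), hU.fromSpec ''ᵁ (PrimeSpectrum.basicOpen f) ≤ hU.fromSpec ''ᵁ ⊤ :=
    fun f => hU.fromSpec.image_mono le_top
  have key : ∀ f : Γ(X, U), M.LocalizesAt (X.basicOpen_le f) f ↔
      M.LocalizesAt (hle f) (resFun X htop.le f) :=
    fun f => ⟨fun h => h.congr' htop.symm (hbas f).symm, fun h => h.congr htop.symm (hbas f).symm⟩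
  let N := M.restrict hU.fromSpec
  have hmod : ∀ (V : (Spec Γ(X, U)).Opens) (hV : hU.fromSpec ''ᵁ V ≤ U) (f : Γ(X, U)) (n : ℕ)
      (x : Γ(M, hU.fromSpec ''ᵁ V)),
      f ^ n • (show Γ(N, V) from x) = resFun X hV f ^ n • x := by
    intro V hV f n x
    rw [fromSpec_smul hU M V hV, map_pow]
  have hmod' : ∀ (f : Γ(X, U)), resFun X (hle f) (resFun X htop.le f) =
        resFun X ((hle f).trans htop.le) f := fun f => resFun_resFun _ _ _
  refine forall_congr' fun f => (key f).trans ?_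
  let φ := ((modulesSpecToSheaf.obj N).obj.map (PrimeSpectrum.basicOpen f).leTop.op).hom
  change _ ↔ IsLocalizedModule (.powers f) φ
  constructor
  · intro h
    refine IsLocalizedModule.Away.mk_of_addCommGroup ?_ ?_ ?_
    · exact N.isUnit_algebraMap_end_of_le_basicOpen f le_rfl
    · intro s
      obtain ⟨n, t, ht⟩ := h.exists_res s
      exact ⟨n, t, (hmod _ _ f n s).trans ((congrArg (fun a => a ^ n • show Γ(M, _) from s)
        (hmod' f)).symm.trans ht.symm)⟩
    · intro t ht
      obtain ⟨n, hn⟩ := h.exists_pow_smul t ht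
      exact ⟨n, (hmod _ _ f n t).trans hn⟩
  · intro h
    constructor
    · intro s
      obtain ⟨⟨t, ⟨_, n, rfl⟩⟩, ht⟩ := h.surj s
      exact ⟨n, t, ht.symm.trans ((hmod _ _ f n s).trans
        (congrArg (fun a => a ^ n • show Γ(M, _) from s) (hmod' f)).symm)⟩
    · intro t ht
      obtain ⟨⟨_, n, rfl⟩, hn⟩ := (IsLocalizedModule.eq_zero_iff (.powers f) φ).mp ht
      exact ⟨n, (hmod _ _ f n t).symm.trans hn⟩

/-- The sections of a quasi-coherent module over an affine open localize. -/
theorem localizes_of_isQuasicoherent (M : X.Modules) (hM : M.IsQuasicoherent) {U : X.Opens}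
    (hU : IsAffineOpen U) : M.Localizes U := by
  rw [localizes_iff_isIso_fromTildeΓ hU]
  have : ((restrictFunctor hU.fromSpec).obj M).IsQuasicoherent := inferInstance
  infer_instance

/-- Transport of a presentation along an isomorphism. -/
noncomputable def presentationOfIso {M N : X.Modules} (e : M ≅ N)
    (P : SheafOfModules.Presentation M) : SheafOfModules.Presentation N :=
  SheafOfModules.Presentation.ofIso (R := X.ringCatSheaf)
    ⟨e.hom, e.inv, e.hom_inv_id, e.inv_hom_id⟩ P

/-- On `Spec Γ(X, U)` the module is the sheaf of its global sections, which has a presentation. This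
is carried along `U ≅ Spec Γ(X, U)` and then to modules over the slice site. -/
theorem nonempty_presentation_over (M : X.Modules) {U : X.Opens} (hU : IsAffineOpen U)
    (h : M.Localizes U) : Nonempty (SheafOfModules.Presentation
      ((SheafOfModules.overFunctor X.ringCatSheaf U).obj M)) := by
  have h1 := (localizes_iff_isIso_fromTildeΓ hU M).1 h
  let N := M.restrict hU.fromSpec
  obtain ⟨P⟩ : Nonempty (SheafOfModules.Presentation N) := by
    let T := (modulesSpecToSheaf.obj N).presheaf.obj (.op ⊤)
    have P : (tilde T).Presentation :=
      presentationTilde T Set.univ (by simp) _ (Submodule.span_eq _)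
    exact ⟨presentationOfIso (@asIso _ _ _ _ _ h1) P⟩
  let iso : restrictFunctor hU.fromSpec ⋙ restrictFunctor hU.isoSpec.hom ≅
      restrictFunctor U.ι :=
    (restrictFunctorComp _ _).symm ≪≫ restrictFunctorCongr (by simp)
  let P' := presentationOfIso (iso.app M) (presentationRestrict hU.isoSpec.hom P)
  let P'' := presentationOfIso ((overFunctorEquiv U).app M).symm P'
  let e : SheafOfModules (X.ringCatSheaf.over U) ≌
      SheafOfModules (U : Scheme.{u}).ringCatSheaf := overEquiv U
  have hcolim : PreservesColimitsOfSize.{u, u} e.inverse :=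
    e.symm.toAdjunction.leftAdjoint_preservesColimits
  let η : e.inverse.obj (SheafOfModules.unit.{u} _) ≅ SheafOfModules.unit.{u} _ :=
    TopologicalSpace.Opens.sheafOfModulesEquivOverInverseUnit U X.ringCatSheaf
  let P3 := SheafOfModules.Presentation.map (R := (U : Scheme.{u}).ringCatSheaf) P'' e.inverse
    η.symm
  exact ⟨SheafOfModules.Presentation.ofIso (e.unitIso.app _).symm P3⟩

/-- A sheaf of modules whose sections over affine opens localize is quasi-coherent. -/
theorem isQuasicoherent_of_localizes (M : X.Modules)
    (h : ∀ U : X.Opens, IsAffineOpen U → M.Localizes U) : M.IsQuasicoherent := by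
  have hpres : ∀ U : X.affineOpens, Nonempty (SheafOfModules.Presentation
      ((SheafOfModules.overFunctor X.ringCatSheaf U.1).obj M)) :=
    fun U => M.nonempty_presentation_over U.2 (h U.1 U.2)
  refine SheafOfModules.QuasicoherentData.isQuasicoherent.{u}
    { I := X.affineOpens
      X := fun U => U.1
      coversTop := ?_
      presentation := fun U => (hpres U).some }
  rw [Opens.coversTop_iff]
  exact iSup_affineOpens_eq_top X

end AlgebraicGeometry.Scheme.Modules

/-! ### Subobjects described by their sections. -/

namespace AlgebraicGeometry.Scheme.Modules
open TopologicalSpace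
variable {X : Scheme.{u}}

/-- A subsheaf of modules of `M`, given by its sections. -/
structure Subsheaf (M : X.Modules) where
  sections (U : X.Opens) : Submodule Γ(X, U) Γ(M, U)
  res_mem {U V : X.Opens} (h : V ≤ U) {x : Γ(M, U)} : x ∈ sections U → M.res h x ∈ sections V
  of_local {U : X.Opens} (x : Γ(M, U)) :
    (∀ p ∈ U, ∃ (V : X.Opens) (h : V ≤ U), p ∈ V ∧ M.res h x ∈ sections V) → x ∈ sections U

/-- The map on sections induced by a morphism of modules, as a linear map. -/
noncomputable def appLinear {M N : X.Modules} (φ : M ⟶ N) (U : X.Opens) :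
    Γ(M, U) →ₗ[Γ(X, U)] Γ(N, U) where
  toFun := φ.app U
  map_add' := map_add _
  map_smul' r x := Hom.app_smul φ r x

theorem appLinear_apply {M N : X.Modules} (φ : M ⟶ N) (U : X.Opens) (x : Γ(M, U)) :
    appLinear φ U x = φ.app U x := rfl

theorem app_injective {M N : X.Modules} (i : N ⟶ M) [Mono i] (U : X.Opens) :
    Function.Injective (i.app U) := by
  have : PreservesLimits (Scheme.Modules.toPresheaf X) := inferInstance
  have : PreservesLimit (cospan i i) (Scheme.Modules.toPresheaf X) := inferInstance
  have hm : Mono (((Scheme.Modules.toPresheaf X).map i).app (op U)) :=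
    (NatTrans.mono_iff_mono_app _).1 ((Scheme.Modules.toPresheaf X).map_mono i) (op U)
  exact (AddCommGrpCat.mono_iff_injective _).1 hm

theorem hom_ext_apply {M N : X.Modules} {f g : M ⟶ N} (h : ∀ U x, f.app U x = g.app U x) :
    f = g := hom_ext _ _ fun U => AddCommGrpCat.hom_ext (AddMonoidHom.ext (h U))

theorem mono_of_injective {M N : X.Modules} (i : N ⟶ M)
    (h : ∀ U, Function.Injective (i.app U)) : Mono i :=
  ⟨fun _ _ hfg => hom_ext_apply fun U x => h U congr(Hom.app $hfg U x)⟩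

/-- A morphism of sheaves of modules from compatible linear maps on sections. -/
noncomputable def homMk {M N : X.Modules} (f : ∀ U, Γ(M, U) →ₗ[Γ(X, U)] Γ(N, U))
    (hf : ∀ {U V : X.Opens} (h : V ≤ U) (x : Γ(M, U)), f V (M.res h x) = N.res h (f U x)) :
    M ⟶ N :=
  SheafOfModules.Hom.mk (X := M) (Y := N) (PresheafOfModules.homMk
    (M₁ := (toPresheafOfModules X).obj M) (M₂ := (toPresheafOfModules X).obj N)
    { app := fun U => AddCommGrpCat.ofHom (f U.unop).toAddMonoidHom
      naturality := fun _ _ g => by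
        ext x
        exact hf g.unop.le x } fun U r x => (f U.unop).map_smul r x)

/-- A morphism whose values are in the image of a monomorphism lifts to the latter. -/
theorem exists_lift {A N M : X.Modules} (i : N ⟶ M) [Mono i] (φ : A ⟶ M)
    (h : ∀ U a, φ.app U a ∈ LinearMap.range (appLinear i U)) : ∃ ψ : A ⟶ N, ψ ≫ i = φ := by
  have hinj : ∀ U, Function.Injective (appLinear i U) := fun U => app_injective i U
  choose g hg using h
  refine ⟨homMk (fun U =>
    { toFun := g U
      map_add' := fun x y => hinj U ?_
      map_smul' := fun r x => hinj U ?_ }) fun {U V} h x => hinj V ?_, ?_⟩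
  · rw [(appLinear i U).map_add, hg, hg, hg]
    exact (appLinear φ U).map_add x y
  · rw [RingHom.id_apply, (appLinear i U).map_smul, hg, hg]
    exact Hom.app_smul φ r x
  · exact (hg V _).trans ((app_res φ h x).trans ((congrArg _ (hg U x).symm).trans
      (app_res i h (g U x)).symm))
  · exact hom_ext_apply fun U x => hg U x

namespace Subsheaf

variable {M : X.Modules} (L : M.Subsheaf)

/-- The presheaf of modules underlying a subsheaf. -/
noncomputable def toSubmodule : ((toPresheafOfModules X).obj M).Submodule where
  obj U := L.sections U.unop
  map f _ hx := L.res_mem f.unop.le hx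

theorem isSheaf :
    TopCat.Presheaf.IsSheaf (X := X.toTopCat) L.toSubmodule.toPresheafOfModules.presheaf := by
  rw [TopCat.Presheaf.isSheaf_iff_isSheafUniqueGluing]
  intro ι V sf hsf
  obtain ⟨t, ht⟩ := M.exists_res_eq V (fun i => le_iSup V i) le_rfl (fun i => (sf i).1)
    fun i j => congrArg Subtype.val (hsf i j)
  have hmem : t ∈ L.sections (iSup V) := by
    refine L.of_local t fun p hp => ?_
    obtain ⟨i, hi⟩ := Opens.mem_iSup.1 hp
    exact ⟨V i, le_iSup V i, hi, by rw [ht]; exact (sf i).2⟩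
  refine ⟨⟨t, hmem⟩, fun i => Subtype.ext (ht i), fun t' ht' => Subtype.ext ?_⟩
  refine M.eq_of_res_eq V (fun i => le_iSup V i) le_rfl fun i => ?_
  rw [ht]
  exact congrArg Subtype.val (ht' i)

/-- The sheaf of modules attached to a subsheaf. -/
noncomputable def toModules : X.Modules :=
  SheafOfModules.mk (R := X.ringCatSheaf) L.toSubmodule.toPresheafOfModules L.isSheaf

/-- The inclusion of a subsheaf. -/
noncomputable def ι : L.toModules ⟶ M :=
  SheafOfModules.Hom.mk (X := L.toModules) (Y := M) L.toSubmodule.ι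

theorem range_ι (U : X.Opens) : LinearMap.range (appLinear L.ι U) = L.sections U :=
  Submodule.range_subtype (L.sections U)

instance : Mono L.ι := mono_of_injective _ fun _ => Subtype.val_injective

end Subsheaf

/-- The sections of a subobject. -/
noncomputable def secs {M : X.Modules} (N : Subobject M) (U : X.Opens) :
    Submodule Γ(X, U) Γ(M, U) := LinearMap.range (appLinear N.arrow U)

theorem secs_mk {A M : X.Modules} (i : A ⟶ M) [Mono i] (U : X.Opens) :
    secs (Subobject.mk i) U = LinearMap.range (appLinear i U) := by
  apply le_antisymm
  · rintro _ ⟨x, rfl⟩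
    refine ⟨(Subobject.underlyingIso i).hom.app U x, ?_⟩
    exact congr(Hom.app $(Subobject.underlyingIso_hom_comp_eq_mk i) U x)
  · rintro _ ⟨x, rfl⟩
    refine ⟨(Subobject.underlyingIso i).inv.app U x, ?_⟩
    exact congr(Hom.app $(Subobject.underlyingIso_arrow i) U x)

theorem res_mem_secs {M : X.Modules} (N : Subobject M) {U V : X.Opens} (h : V ≤ U)
    {x : Γ(M, U)} (hx : x ∈ secs N U) : M.res h x ∈ secs N V := by
  obtain ⟨y, rfl⟩ := hx
  exact ⟨res _ h y, app_res N.arrow h y⟩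

theorem mem_range_of_local {A M : X.Modules} (i : A ⟶ M) [Mono i] {U : X.Opens} (x : Γ(M, U))
    (h : ∀ p ∈ U, ∃ (V : X.Opens) (h : V ≤ U), p ∈ V ∧
      M.res h x ∈ LinearMap.range (appLinear i V)) : x ∈ LinearMap.range (appLinear i U) := by
  choose V hV hpV y hy using fun p : U => h p.1 p.2
  have hcov : U ≤ ⨆ p, V p := fun p hp => Opens.mem_iSup.2 ⟨⟨p, hp⟩, hpV _⟩
  obtain ⟨t, ht⟩ := A.exists_res_eq V hV hcov y fun p p' => by
    apply app_injective i
    rw [app_res, app_res]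
    refine (congrArg _ (hy p)).trans (Eq.trans ?_ (congrArg _ (hy p')).symm)
    rw [res_res, res_res]
  refine ⟨t, M.eq_of_res_eq V hV hcov fun p => ?_⟩
  rw [← hy p, ← ht p]
  exact (app_res i (hV p) t).symm

theorem mem_secs_of_local {M : X.Modules} (N : Subobject M) {U : X.Opens} (x : Γ(M, U))
    (h : ∀ p ∈ U, ∃ (V : X.Opens) (h : V ≤ U), p ∈ V ∧ M.res h x ∈ secs N V) :
    x ∈ secs N U := mem_range_of_local N.arrow x h

theorem factors_iff {A M : X.Modules} (N : Subobject M) (φ : A ⟶ M) :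
    N.Factors φ ↔ ∀ U x, φ.app U x ∈ secs N U := by
  constructor
  · intro h U x
    exact ⟨(N.factorThru φ h).app U x, congr(Hom.app $(N.factorThru_arrow φ h) U x)⟩
  · intro h
    obtain ⟨ψ, hψ⟩ := exists_lift N.arrow φ h
    exact Subobject.factors_of_factors_right ψ (N.factors_self) |> fun h => hψ ▸ h

theorem le_iff_secs {M : X.Modules} {N N' : Subobject M} :
    N ≤ N' ↔ ∀ U, secs N U ≤ secs N' U := by
  constructor
  · rintro h U _ ⟨x, rfl⟩
    exact ⟨(Subobject.ofLE N N' h).app U x, congr(Hom.app $(Subobject.ofLE_arrow h) U x)⟩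
  · intro h
    obtain ⟨ψ, hψ⟩ := exists_lift N'.arrow N.arrow fun U x => h U ⟨x, rfl⟩
    exact Subobject.le_of_comm ψ hψ

theorem secs_bot {M : X.Modules} (U : X.Opens) : secs (⊥ : Subobject M) U = ⊥ := by
  rw [eq_bot_iff]
  rintro _ ⟨x, rfl⟩
  rw [Submodule.mem_bot]
  exact congr(Hom.app $(Subobject.bot_arrow (B := M)) U x)

theorem secs_top {M : X.Modules} (U : X.Opens) : secs (⊤ : Subobject M) U = ⊤ := by
  rw [Subobject.top_eq_id, secs_mk, eq_top_iff]
  exact fun x _ => ⟨x, rfl⟩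

theorem secs_kernel {M N : X.Modules} (φ : M ⟶ N) (U : X.Opens) :
    secs (kernelSubobject φ) U = LinearMap.ker (appLinear φ U) := by
  let L : M.Subsheaf :=
    { sections := fun U => LinearMap.ker (appLinear φ U)
      res_mem := fun {U V} h x hx => by
        rw [LinearMap.mem_ker, appLinear_apply] at hx ⊢
        rw [app_res, hx, map_zero]
      of_local := fun {U} x hx => by
        rw [LinearMap.mem_ker, appLinear_apply]
        choose V hV hpV h using fun p : U => hx p.1 p.2
        refine N.eq_of_res_eq V hV (fun p hp => Opens.mem_iSup.2 ⟨⟨p, hp⟩, hpV _⟩) fun p => ?_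
        rw [← app_res, map_zero]
        exact h p }
  apply le_antisymm
  · rintro _ ⟨x, rfl⟩
    exact congr(Hom.app $(kernelSubobject_arrow_comp φ) U x)
  · have h : L.ι ≫ φ = 0 := hom_ext_apply fun U x => x.2
    have := le_iff_secs.1 (Subobject.mk_le_of_comm (X := kernelSubobject φ) (f := L.ι)
      (factorThruKernelSubobject φ L.ι h) (factorThruKernelSubobject_comp_arrow ..)) U
    rwa [secs_mk, L.range_ι] at this

/-- The sections lying locally in the range form a subsheaf through which `φ` factors, so it
contains the image. The converse is gluing. -/
theorem mem_secs_image {M N : X.Modules} (φ : M ⟶ N) {U : X.Opens} (y : Γ(N, U)) :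
    y ∈ secs (imageSubobject φ) U ↔ ∀ p ∈ U, ∃ (V : X.Opens) (h : V ≤ U), p ∈ V ∧
      N.res h y ∈ LinearMap.range (appLinear φ V) := by
  have hres : ∀ {U V : X.Opens} (h : V ≤ U) {y : Γ(N, U)},
      y ∈ LinearMap.range (appLinear φ U) → N.res h y ∈ LinearMap.range (appLinear φ V) := by
    rintro U V h _ ⟨x, rfl⟩
    exact ⟨M.res h x, app_res φ h x⟩
  have hincl : ∀ V, LinearMap.range (appLinear φ V) ≤ secs (imageSubobject φ) V := by
    rintro V _ ⟨x, rfl⟩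
    exact ⟨(factorThruImageSubobject φ).app V x,
      congr(Hom.app $(imageSubobject_arrow_comp φ) V x)⟩
  let L : N.Subsheaf :=
    { sections := fun U =>
        { carrier := {y | ∀ p ∈ U, ∃ (V : X.Opens) (h : V ≤ U), p ∈ V ∧
            N.res h y ∈ LinearMap.range (appLinear φ V)}
          zero_mem' := fun p hp => ⟨U, le_rfl, hp, by rw [map_zero]; exact zero_mem _⟩
          add_mem' := fun {a b} ha hb p hp => by
            obtain ⟨V, h, hV, hm⟩ := ha p hp
            obtain ⟨V', h', hV', hm'⟩ := hb p hp
            refine ⟨V ⊓ V', inf_le_left.trans h, ⟨hV, hV'⟩, ?_⟩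
            rw [map_add, ← N.res_res h inf_le_left a, ← N.res_res h' inf_le_right b]
            exact add_mem (hres _ hm) (hres _ hm')
          smul_mem' := fun r a ha p hp => by
            obtain ⟨V, h, hV, hm⟩ := ha p hp
            refine ⟨V, h, hV, ?_⟩
            rw [res_smul]
            exact Submodule.smul_mem _ _ hm }
      res_mem := fun {U V} h x hx p hp => by
        obtain ⟨W, hW, hpW, hm⟩ := hx p (h hp)
        refine ⟨V ⊓ W, inf_le_left, ⟨hp, hpW⟩, ?_⟩
        have := hres (inf_le_right : V ⊓ W ≤ W) hm
        rwa [res_res] at this ⊢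
      of_local := fun {U} x hx p hp => by
        obtain ⟨V, h, hV, hm⟩ := hx p hp
        obtain ⟨W, hW, hpW, hm⟩ := hm p hV
        refine ⟨W, hW.trans h, hpW, ?_⟩
        rwa [res_res] at hm }
  constructor
  · intro hy
    have hle : imageSubobject φ ≤ Subobject.mk L.ι := by
      obtain ⟨ψ, hψ⟩ := exists_lift L.ι φ fun U x => by
        rw [L.range_ι]
        exact fun p hp => ⟨U, le_rfl, hp, by rw [res_self]; exact ⟨x, rfl⟩⟩
      exact imageSubobject_le_mk _ _ ψ hψ
    have := le_iff_secs.1 hle U hy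
    rw [secs_mk, L.range_ι] at this
    exact this
  · intro hy
    refine mem_secs_of_local _ _ fun p hp => ?_
    obtain ⟨V, h, hV, hm⟩ := hy p hp
    exact ⟨V, h, hV, hincl V hm⟩

end AlgebraicGeometry.Scheme.Modules

/-! ### Kernels, images and inclusions over affine opens. -/

namespace AlgebraicGeometry.Scheme.Modules
open TopologicalSpace
variable {X : Scheme.{u}}

theorem LocalizesAt.exists_pow_smul_eq {M : X.Modules} {U W : X.Opens} {h : W ≤ U} {f : Γ(X, U)}
    (H : M.LocalizesAt h f) {x y : Γ(M, U)} (hxy : M.res h x = M.res h y) :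
    ∃ n : ℕ, f ^ n • x = f ^ n • y := by
  obtain ⟨n, hn⟩ := H.exists_pow_smul (x - y) (by rw [map_sub, hxy, sub_self])
  exact ⟨n, by rwa [smul_sub, sub_eq_zero] at hn⟩

theorem isUnit_resFun_basicOpen {U : X.Opens} (f : Γ(X, U)) :
    IsUnit (resFun X (X.basicOpen_le f) f) :=
  RingedSpace.isUnit_res_basicOpen _ f

theorem res_pow_smul (M : X.Modules) {U V : X.Opens} (h : V ≤ U) (f : Γ(X, U)) (n : ℕ)
    (x : Γ(M, U)) : M.res h (f ^ n • x) = resFun X h f ^ n • M.res h x := by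
  rw [res_smul, map_pow]

/-- A submodule localizes if its sections over `D(f)` extend up to powers of `f`. -/
theorem localizes_of_mono {A M : X.Modules} (i : A ⟶ M) [Mono i] {U : X.Opens}
    (hM : M.Localizes U)
    (h : ∀ (f : Γ(X, U)), ∀ s ∈ LinearMap.range (appLinear i (X.basicOpen f)), ∃ n : ℕ,
      ∃ t ∈ LinearMap.range (appLinear i U),
        M.res (X.basicOpen_le f) t = resFun X (X.basicOpen_le f) f ^ n • s) :
    A.Localizes U := by
  intro f
  constructor
  · intro s
    obtain ⟨n, _, ⟨t, rfl⟩, ht⟩ := h f _ ⟨s, rfl⟩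
    refine ⟨n, t, app_injective i _ ?_⟩
    rw [app_res]
    exact ht.trans ((appLinear i _).map_smul _ _).symm
  · intro t ht
    obtain ⟨n, hn⟩ := (hM f).exists_pow_smul (i.app U t) (by rw [← app_res, ht, map_zero])
    refine ⟨n, app_injective i _ ?_⟩
    rw [map_zero]
    exact ((appLinear i U).map_smul _ _).trans hn

theorem localizes_kernel {A B : X.Modules} (φ : A ⟶ B) {U : X.Opens} (hA : A.Localizes U)
    (hB : B.Localizes U) : ((kernelSubobject φ : Subobject A) : X.Modules).Localizes U := by
  refine localizes_of_mono (kernelSubobject φ).arrow hA fun f s hs => ?_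
  change s ∈ secs _ _ at hs
  rw [secs_kernel, LinearMap.mem_ker, appLinear_apply] at hs
  obtain ⟨n, t, ht⟩ := (hA f).exists_res s
  obtain ⟨m, hm⟩ := (hB f).exists_pow_smul (φ.app U t) (by
    rw [← app_res, ht]
    refine ((appLinear φ _).map_smul _ _).trans ?_
    rw [appLinear_apply, hs, smul_zero])
  -- `f ^ n` clears the denominator of `s`, and the extra `f ^ m` kills `φ(t)`, which vanishes only
  -- on `D(f)`.
  refine ⟨m + n, f ^ m • t, ?_, by rw [res_pow_smul, ht, smul_smul, pow_add]⟩
  change _ ∈ secs _ _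
  rw [secs_kernel, LinearMap.mem_ker, (appLinear φ U).map_smul]
  exact hm

/-- Over an affine open the sections of the image are the image of the sections. -/
theorem secs_image {A B : X.Modules} (φ : A ⟶ B) {U : X.Opens} (hU : IsAffineOpen U)
    (hA : A.Localizes U) (hB : B.Localizes U) :
    secs (imageSubobject φ) U = LinearMap.range (appLinear φ U) := by
  ext y
  rw [mem_secs_image]
  constructor
  · intro hy
    -- The opens `D(f)` with `f ∈ S` cover `U`, so `S` generates the unit ideal and `y` lies in the
    -- range.
    let S : Set Γ(X, U) := {f | ∃ n, f ^ n • y ∈ LinearMap.range (appLinear φ U)}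
    refine Submodule.mem_of_span_eq_top_of_smul_pow_mem _ S ?_ y fun r => r.2
    rw [← hU.self_le_iSup_basicOpen_iff]
    intro p hp
    obtain ⟨V, hVU, hpV, a, ha⟩ := hy p hp
    obtain ⟨f, hfV, hpf⟩ := hU.exists_basicOpen_le ⟨p, hpV⟩ hp
    refine Opens.mem_iSup.2 ⟨⟨f, ?_⟩, hpf⟩
    obtain ⟨n, b, hb⟩ := (hA f).exists_res (A.res hfV a)
    obtain ⟨m, hm⟩ := (hB f).exists_pow_smul_eq (x := f ^ n • y) (y := φ.app U b) (by
      rw [← app_res, hb, res_pow_smul]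
      refine Eq.trans ?_ ((appLinear φ _).map_smul _ _).symm
      rw [appLinear_apply, app_res]
      refine congrArg _ (Eq.trans ?_ (congrArg _ ha.symm))
      rw [res_res])
    refine ⟨m + n, f ^ m • b, ?_⟩
    rw [(appLinear φ U).map_smul, pow_add, ← smul_smul]
    exact hm.symm
  · intro hy p hp
    exact ⟨U, le_rfl, hp, by rwa [res_self]⟩

theorem localizes_image {A B : X.Modules} (φ : A ⟶ B) {U : X.Opens} (hU : IsAffineOpen U)
    (hA : ∀ V, IsAffineOpen V → A.Localizes V) (hB : ∀ V, IsAffineOpen V → B.Localizes V) :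
    ((imageSubobject φ : Subobject B) : X.Modules).Localizes U := by
  refine localizes_of_mono (imageSubobject φ).arrow (hB U hU) fun f s hs => ?_
  have hf := hU.basicOpen f
  change s ∈ secs _ _ at hs
  rw [secs_image φ hf (hA _ hf) (hB _ hf)] at hs
  obtain ⟨a, rfl⟩ := hs
  obtain ⟨n, t, ht⟩ := (hA U hU f).exists_res a
  refine ⟨n, φ.app U t, ?_, ?_⟩
  · change _ ∈ secs _ _
    rw [secs_image φ hU (hA _ hU) (hB _ hU)]
    exact ⟨t, rfl⟩
  · rw [← app_res, ht]
    exact (appLinear φ _).map_smul _ _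

/-- Inclusions of quasi-coherent submodules may be checked on an affine cover. -/
theorem le_of_secs_le {M : X.Modules} {N N' : Subobject M} {ι : Type*} (V : ι → X.Opens)
    (hV : ∀ i, IsAffineOpen (V i)) (hcov : ⨆ i, V i = ⊤)
    (hN : ∀ i, (N : X.Modules).Localizes (V i)) (h : ∀ i, secs N (V i) ≤ secs N' (V i)) :
    N ≤ N' := by
  rw [le_iff_secs]
  intro U x hx
  refine mem_secs_of_local N' x fun p hp => ?_
  obtain ⟨i, hi⟩ := Opens.mem_iSup.1 (hcov.ge (Opens.mem_top p))
  obtain ⟨f, hfU, hpf⟩ := (hV i).exists_basicOpen_le ⟨p, hp⟩ hi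
  refine ⟨_, hfU, hpf, ?_⟩
  obtain ⟨y, rfl⟩ := hx
  obtain ⟨n, t, ht⟩ := (hN i f).exists_res (res _ hfU y)
  have hmem := res_mem_secs N' (X.basicOpen_le f) (h i ⟨t, rfl⟩)
  rw [appLinear_apply, ← app_res, ht] at hmem
  have hmem' : resFun X (X.basicOpen_le f) f ^ n • M.res hfU (appLinear N.arrow U y) ∈
      secs N' (X.basicOpen f) := by
    refine Set.mem_of_eq_of_mem ?_ hmem
    rw [appLinear_apply, ← app_res]
    exact ((appLinear N.arrow _).map_smul _ _).symm
  exact (Submodule.smul_mem_iff_of_isUnit _ ((isUnit_resFun_basicOpen f).pow n)).1 hmem'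

theorem exists_finite_affine_cover [CompactSpace X] :
    ∃ (ι : Type) (_ : Finite ι) (V : ι → X.Opens), (∀ i, IsAffineOpen (V i)) ∧ ⨆ i, V i = ⊤ := by
  obtain ⟨t, ht⟩ := isCompact_univ.elim_finite_subcover (fun U : X.affineOpens => (U.1 : Set X))
    (fun U => U.1.isOpen) (fun x _ => by
      obtain ⟨U, hU⟩ := Opens.mem_iSup.1 ((iSup_affineOpens_eq_top X).ge (Opens.mem_top x))
      exact Set.mem_iUnion.2 ⟨U, hU⟩)
  refine ⟨Fin t.card, inferInstance, fun i => (t.equivFin.symm i).1.1,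
    fun i => (t.equivFin.symm i).1.2, ?_⟩
  rw [eq_top_iff]
  intro x _
  obtain ⟨U, hU, hx⟩ := Set.mem_iUnion₂.1 (ht (Set.mem_univ x))
  exact Opens.mem_iSup.2 ⟨t.equivFin ⟨U, hU⟩, by simpa using hx⟩

end AlgebraicGeometry.Scheme.Modules

/-! ### Cartier operators on sections over affine opens. -/

namespace CartierModules
open AlgebraicGeometry.Scheme.Modules

variable {𝔽 : Type u} [Field 𝔽] [Fintype 𝔽] {X : Scheme.{u}} (s : X ⟶ Spec (CommRingCat.of 𝔽))

theorem pushforward_frobenius_localizes {M : X.Modules} {U : X.Opens} (hM : M.Localizes U) :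
    ((Scheme.Modules.pushforward (frobenius s)).obj M).Localizes U := by
  intro f
  constructor
  · intro x
    obtain ⟨n, t, ht⟩ := (hM f).exists_res x
    let x' : Γ(M, X.basicOpen f) := x
    -- On `F_* M` the scalar `f ^ n` acts as `f ^ (n q)`, and the missing `n (q - 1)` factors are
    -- put into `t`.
    refine ⟨n, f ^ (n * (Fintype.card 𝔽 - 1)) • t, ?_⟩
    refine (res_smul M _ _ _).trans ((congrArg _ ht).trans ?_)
    change resFun X _ _ • (resFun X _ f ^ n • x') =
      ((resFun X (X.basicOpen_le f) f) ^ n) ^ Fintype.card 𝔽 • x'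
    rw [smul_smul, map_pow, ← pow_add, ← pow_mul]
    congr 2
    have : 1 ≤ Fintype.card 𝔽 := Fintype.card_pos
    obtain ⟨k, hk⟩ := Nat.exists_eq_add_of_le this
    rw [hk, Nat.add_sub_cancel_left]
    ring
  · intro t ht
    obtain ⟨n, hn⟩ := (hM f).exists_pow_smul t ht
    let t' : Γ(M, U) := t
    refine ⟨n, ?_⟩
    change (f ^ n) ^ Fintype.card 𝔽 • t' = 0
    have : 1 ≤ Fintype.card 𝔽 := Fintype.card_pos
    obtain ⟨k, hk⟩ := Nat.exists_eq_add_of_le this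
    rw [hk, add_comm, pow_succ, ← smul_smul]
    exact (congrArg _ hn).trans (smul_zero _)

theorem two_le_card : 2 ≤ Fintype.card 𝔽 := Fintype.one_lt_card

theorem _root_.FrobeniusFinite.of_finite {q : ℕ} {R : Type*} [CommRing R] (φ : R →+* R)
    (hφ : ∀ r, φ r = r ^ q) (h : φ.Finite) : FrobeniusFinite q R := by
  have : Module.Finite R (EndoModule φ) := h
  obtain ⟨k, b, hb⟩ := Module.Finite.exists_fin (R := R) (M := EndoModule φ)
  refine ⟨k, b, fun r => ?_⟩
  have hr : (show EndoModule φ from r) ∈ Submodule.span R (Set.range b) := by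
    rw [hb]
    exact Submodule.mem_top
  obtain ⟨c, hc⟩ := Submodule.mem_span_range_iff_exists_fun R |>.1 hr
  refine ⟨c, hc.symm.trans ?_⟩
  simp only [EndoModule.smul_def, hφ]
  rfl

theorem frobeniusFinite [IsFinite (frobenius s)] {U : X.Opens} (hU : IsAffineOpen U) :
    FrobeniusFinite (Fintype.card 𝔽) Γ(X, U) :=
  .of_finite (frobSection s U) (frobSection_apply s U)
    (IsFinite.finite_app (f := frobenius s) U hU)

namespace CohCart
variable {s}

theorem localizes (M : CohCart s) (U : X.Opens) (hU : IsAffineOpen U) : M.module.Localizes U :=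
  M.module.localizes_of_isQuasicoherent M.coherent.quasicoherent hU

/-- The operator on sections given by the structural map. -/
noncomputable def op (M : CohCart s) (U : X.Opens) :
    CartierOp (Fintype.card 𝔽) Γ(X, U) Γ(M.module, U) where
  toFun := M.C.app U
  map_zero' := map_zero (M.C.app U).hom
  map_add' := map_add (M.C.app U).hom
  pow_smul' := M.C_pow_smul U

/-- The map whose image is `C(N)`. -/
noncomputable abbrev imageMap (M : CohCart s) (N : Subobject M.module) :
    (Scheme.Modules.pushforward (frobenius s)).obj (N : X.Modules) ⟶ M.module :=
  (Scheme.Modules.pushforward (frobenius s)).map N.arrow ≫ M.C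

theorem range_imageMap (M : CohCart s) (N : Subobject M.module) (U : X.Opens) :
    LinearMap.range (appLinear (M.imageMap N) U) = (M.op U).image (secs N U) := by
  ext y
  constructor
  · rintro ⟨x, rfl⟩
    exact ⟨N.arrow.app U x, ⟨x, rfl⟩, rfl⟩
  · rintro ⟨_, ⟨x, rfl⟩, rfl⟩
    exact ⟨x, rfl⟩

theorem secs_image (M : CohCart s) {N : Subobject M.module} (hN : (N : X.Modules).IsQuasicoherent)
    {U : X.Opens} (hU : IsAffineOpen U) :
    secs (M.image N) U = (M.op U).image (secs N U) := by
  rw [← range_imageMap]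
  exact Scheme.Modules.secs_image _ hU
    (pushforward_frobenius_localizes s (localizes_of_isQuasicoherent _ hN hU)) (M.localizes U hU)

theorem isQuasicoherent_image (M : CohCart s) {N : Subobject M.module}
    (hN : (N : X.Modules).IsQuasicoherent) : (M.image N : X.Modules).IsQuasicoherent :=
  isQuasicoherent_of_localizes _ fun _ hU => localizes_image _ hU
    (fun _ hV => pushforward_frobenius_localizes s (localizes_of_isQuasicoherent _ hN hV))
    (fun V hV => M.localizes V hV)

theorem isQuasicoherent_imageIter (M : CohCart s) {N : Subobject M.module}
    (hN : (N : X.Modules).IsQuasicoherent) (e : ℕ) :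
    (M.imageIter e N : X.Modules).IsQuasicoherent := by
  induction e with
  | zero => exact hN
  | succ e ih =>
    rw [imageIter, Function.iterate_succ_apply']
    exact M.isQuasicoherent_image ih

theorem secs_imageIter (M : CohCart s) {N : Subobject M.module}
    (hN : (N : X.Modules).IsQuasicoherent) (e : ℕ) {U : X.Opens} (hU : IsAffineOpen U) :
    secs (M.imageIter e N) U = (M.op U).image^[e] (secs N U) := by
  induction e with
  | zero => rfl
  | succ e ih =>
    rw [Function.iterate_succ_apply', ← ih, ← M.secs_image (M.isQuasicoherent_imageIter hN e) hU,
      imageIter, Function.iterate_succ_apply']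
    rfl

theorem image_mono (M : CohCart s) : Monotone M.image := by
  intro N N' h
  refine le_iff_secs.2 fun U y hy => (mem_secs_image _ y).2 fun p hp => ?_
  obtain ⟨V, hV, hpV, hm⟩ := (mem_secs_image _ y).1 hy p hp
  refine ⟨V, hV, hpV, ?_⟩
  rw [range_imageMap] at hm ⊢
  exact (M.op V).image_mono (le_iff_secs.1 h V) hm

end CohCart
end CartierModules

namespace CartierOp
variable {q : ℕ} {R M : Type*} [CommRing R] [AddCommGroup M] [Module R M] (C : CartierOp q R M)

theorem mem_iterate_image {N : Submodule R M} {e : ℕ} {x : M} :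
    x ∈ C.image^[e] N ↔ ∃ y ∈ N, C^[e] y = x := by
  induction e generalizing x with
  | zero => simp
  | succ e ih =>
    rw [Function.iterate_succ_apply', mem_image]
    constructor
    · rintro ⟨_, hy, rfl⟩
      obtain ⟨z, hz, rfl⟩ := ih.1 hy
      exact ⟨z, hz, Function.iterate_succ_apply' ..⟩
    · rintro ⟨z, hz, rfl⟩
      exact ⟨_, ih.2 ⟨z, hz, rfl⟩, (Function.iterate_succ_apply' ..).symm⟩

end CartierOp

/-! ### Globalization: finiteness and stabilization on `X`. -/

namespace CartierModules
open AlgebraicGeometry.Scheme.Modules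

variable {𝔽 : Type u} [Field 𝔽] [Fintype 𝔽] {X : Scheme.{u}} {s : X ⟶ Spec (CommRingCat.of 𝔽)}

namespace CohCart

theorem le_of_affine {M : CohCart s} {N N' : Subobject M.module}
    (hN : (N : X.Modules).IsQuasicoherent)
    (h : ∀ U, IsAffineOpen U → secs N U ≤ secs N' U) : N ≤ N' :=
  le_of_secs_le (fun U : X.affineOpens => U.1) (fun U => U.2) (iSup_affineOpens_eq_top X)
    (fun U => localizes_of_isQuasicoherent _ hN U.2) fun U => h U.1 U.2

theorem image_le_of_affine {M : CohCart s} {N N' : Subobject M.module}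
    (hN : (N : X.Modules).IsQuasicoherent)
    (h : ∀ U, IsAffineOpen U → ∀ x ∈ secs N U, M.op U x ∈ secs N' U) : M.image N ≤ N' :=
  le_of_affine (M.isQuasicoherent_image hN) fun U hU => by
    rw [M.secs_image hN hU, CartierOp.image_le_iff]
    exact h U hU

theorem imageIter_le_iff {M : CohCart s} {N N' : Subobject M.module}
    (hN : (N : X.Modules).IsQuasicoherent) (e : ℕ) : M.imageIter e N ≤ N' ↔
      ∀ U, IsAffineOpen U → ∀ x ∈ secs N U, (M.op U)^[e] x ∈ secs N' U := by
  constructor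
  · intro h U hU x hx
    have := le_iff_secs.1 h U
    rw [M.secs_imageIter hN e hU] at this
    exact this ((M.op U).mem_iterate_image.2 ⟨x, hx, rfl⟩)
  · intro h
    refine le_of_affine (M.isQuasicoherent_imageIter hN e) fun U hU => ?_
    rw [M.secs_imageIter hN e hU]
    intro y hy
    obtain ⟨x, hx, rfl⟩ := (M.op U).mem_iterate_image.1 hy
    exact h U hU x hx

theorem image_secs_le {M : CohCart s} (N : M.CartierSubmodule) {U : X.Opens}
    (hU : IsAffineOpen U) : (M.op U).image (secs N.1 U) ≤ secs N.1 U := by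
  rw [← M.secs_image N.2.1 hU]
  exact le_iff_secs.1 N.2.2 U

/-- A quasi-coherent submodule is determined by its sections on a finite affine cover, and each
chart allows finitely many values. -/
theorem finite_fixedSubmodule [IsNoetherian X] [IsFinite (frobenius s)] (M : CohCart s) :
    Finite M.FixedSubmodule := by
  obtain ⟨ι, _, V, hV, hcov⟩ := exists_finite_affine_cover (X := X)
  let T (i : ι) := {L : Submodule Γ(X, V i) Γ(M.module, V i) // (M.op (V i)).image L = L}
  have hT (i : ι) : Finite (T i) := by
    have : IsNoetherianRing Γ(X, V i) := IsLocallyNoetherian.component_noetherian ⟨V i, hV i⟩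
    have := M.coherent.finite (V i) (hV i)
    exact (CartierOp.finite_fixed two_le_card (frobeniusFinite s (hV i)) (frobSection s (V i))
      (frobSection_apply s (V i)) _ (M.op (V i))).to_subtype
  let F : M.FixedSubmodule → ∀ i, T i := fun N i => ⟨secs N.1 (V i), by
    rw [← M.secs_image N.2.1 (hV i), N.2.2]⟩
  have key {N N' : M.FixedSubmodule} (h : F N = F N') : N.1 ≤ N'.1 :=
    le_of_secs_le V hV hcov (fun i => localizes_of_isQuasicoherent _ N.2.1 (hV i))
      fun i => (congrArg Subtype.val (congrFun h i)).le
  exact Finite.of_injective F fun N N' h => Subtype.ext ((key h).antisymm (key h.symm))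

theorem exists_imageIter_eq [IsNoetherian X] {M : CohCart s} (N : M.CartierSubmodule) :
    ∃ e, M.imageIter (e + 1) N.1 = M.imageIter e N.1 := by
  obtain ⟨ι, _, V, hV, hcov⟩ := exists_finite_affine_cover (X := X)
  have hstab (i : ι) : ∃ e, (M.op (V i)).image^[e + 1] (secs N.1 (V i)) =
      (M.op (V i)).image^[e] (secs N.1 (V i)) := by
    have : IsNoetherianRing Γ(X, V i) := IsLocallyNoetherian.component_noetherian ⟨V i, hV i⟩
    have := M.coherent.finite (V i) (hV i)
    exact CartierOp.exists_iterate_image_eq two_le_card _ (image_secs_le N (hV i))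
  choose e he using hstab
  -- The cover is finite, so a single exponent serves all charts.
  obtain ⟨n, hn⟩ := (Set.finite_range e).bddAbove
  have hsecs (i : ι) : secs (M.imageIter (n + 1) N.1) (V i) = secs (M.imageIter n N.1) (V i) := by
    rw [M.secs_imageIter N.2.1 _ (hV i), M.secs_imageIter N.2.1 _ (hV i)]
    obtain ⟨k, rfl⟩ := Nat.exists_eq_add_of_le' (hn ⟨i, rfl⟩)
    rw [add_assoc, Function.iterate_add_apply, he, ← Function.iterate_add_apply]
  refine ⟨n, le_antisymm ?_ ?_⟩
  · exact le_of_secs_le V hV hcov (fun i => localizes_of_isQuasicoherent _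
      (M.isQuasicoherent_imageIter N.2.1 _) (hV i)) fun i => (hsecs i).le
  · exact le_of_secs_le V hV hcov (fun i => localizes_of_isQuasicoherent _
      (M.isQuasicoherent_imageIter N.2.1 _) (hV i)) fun i => (hsecs i).ge

theorem imageIter_succ (M : CohCart s) (e : ℕ) (N : Subobject M.module) :
    M.imageIter (e + 1) N = M.image (M.imageIter e N) := Function.iterate_succ_apply' ..

theorem imageIter_eq_of_le {M : CohCart s} {N : Subobject M.module} {e : ℕ}
    (h : M.imageIter (e + 1) N = M.imageIter e N) {n : ℕ} (hn : e ≤ n) :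
    M.imageIter n N = M.imageIter e N := by
  induction n, hn using Nat.le_induction with
  | base => rfl
  | succ n _ ih => rw [imageIter_succ, ih, ← imageIter_succ, h]

theorem imageIter_eq_self {M : CohCart s} (N : M.FixedSubmodule) (n : ℕ) :
    M.imageIter n N.1 = N.1 :=
  imageIter_eq_of_le (e := 0) N.2.2 n.zero_le

theorem imageIter_le {M : CohCart s} (N : M.CartierSubmodule) (n : ℕ) :
    M.imageIter n N.1 ≤ N.1 := by
  induction n with
  | zero => exact le_rfl
  | succ n ih => exact (M.imageIter_succ n N.1).trans_le ((M.image_mono ih).trans N.2.2)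

theorem exists_stable [IsNoetherian X] {M : CohCart s} (N : M.CartierSubmodule) :
    ∃ (L : M.FixedSubmodule) (e : ℕ), ∀ n ≥ e, M.imageIter n N.1 = L.1 := by
  obtain ⟨e, he⟩ := exists_imageIter_eq N
  exact ⟨⟨M.imageIter e N.1, M.isQuasicoherent_imageIter N.2.1 e,
    (M.imageIter_succ e N.1).symm.trans he⟩, e, fun n hn => imageIter_eq_of_le he hn⟩

/-- Classes up to nilpotence are separated by their stable values, which are fixed submodules. -/
theorem finite_quotient [IsNoetherian X] [IsFinite (frobenius s)] (M : CohCart s) :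
    Finite (Quotient M.equalUpToNilpotence) := by
  have := M.finite_fixedSubmodule
  choose L e he using fun N : M.CartierSubmodule => exists_stable N
  refine Finite.of_injective (fun N => L N.out) fun N N' (h : L N.out = L N'.out) => ?_
  rw [← N.out_eq, ← N'.out_eq]
  refine Quotient.sound ⟨max (e N.out) (e N'.out), fun n hn => ?_⟩
  rw [he _ n ((le_max_left _ _).trans hn), he _ n ((le_max_right _ _).trans hn), h]

theorem Hom.app_op {M N : CohCart s} (φ : M ⟶ N) (U : X.Opens) (x : Γ(M.module, U)) :
    φ.hom.app U (M.op U x) = N.op U (φ.hom.app U x) :=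
  congr(Scheme.Modules.Hom.app $(φ.comm) U x).symm

theorem Hom.app_iterate_op {M N : CohCart s} (φ : M ⟶ N) (U : X.Opens) (e : ℕ)
    (x : Γ(M.module, U)) :
    φ.hom.app U ((M.op U)^[e] x) = (N.op U)^[e] (φ.hom.app U x) := by
  induction e generalizing x with
  | zero => rfl
  | succ e ih => rw [Function.iterate_succ_apply, ih, Hom.app_op, Function.iterate_succ_apply]

theorem comp_app {A B D : CohCart s} (f : A ⟶ B) (g : B ⟶ D) (U : X.Opens)
    (x : Γ(A.module, U)) : (f ≫ g).hom.app U x = g.hom.app U (f.hom.app U x) := rfl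

theorem isQuasicoherent_kernel {M : CohCart s} {B : X.Modules} (hB : B.IsQuasicoherent)
    (φ : M.module ⟶ B) : ((kernelSubobject φ : Subobject _) : X.Modules).IsQuasicoherent :=
  isQuasicoherent_of_localizes _ fun U hU => localizes_kernel φ (M.localizes U hU)
    (localizes_of_isQuasicoherent _ hB hU)

theorem secs_imageSubobject {M N : CohCart s} (φ : M ⟶ N) {U : X.Opens} (hU : IsAffineOpen U) :
    secs (imageSubobject φ.hom) U = LinearMap.range (appLinear φ.hom U) :=
  Scheme.Modules.secs_image _ hU (M.localizes U hU) (N.localizes U hU)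

theorem isQuasicoherent_top (M : CohCart s) :
    ((⊤ : Subobject M.module) : X.Modules).IsQuasicoherent := by
  refine isQuasicoherent_of_localizes _ fun U hU => ?_
  refine localizes_of_mono (⊤ : Subobject M.module).arrow (M.localizes U hU) fun f x _ => ?_
  obtain ⟨n, t, ht⟩ := (M.localizes U hU f).exists_res x
  exact ⟨n, t, (secs_top U).ge Submodule.mem_top, ht⟩

/-- The Cartier submodule on which two maps agree. -/
noncomputable def eqSub {A B : CohCart s} (f g : A ⟶ B) : A.CartierSubmodule :=
  ⟨kernelSubobject (f.hom - g.hom), isQuasicoherent_kernel B.coherent.quasicoherent _,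
    image_le_of_affine (isQuasicoherent_kernel B.coherent.quasicoherent _) fun U _ x hx => by
      rw [secs_kernel, LinearMap.mem_ker] at hx ⊢
      have hx : f.hom.app U x - g.hom.app U x = 0 := hx
      change f.hom.app U _ - g.hom.app U _ = 0
      rw [Hom.app_op, Hom.app_op, ← map_sub, hx, map_zero]⟩

theorem mem_secs_eqSub {A B : CohCart s} {f g : A ⟶ B} {U : X.Opens} {x : Γ(A.module, U)} :
    x ∈ secs (eqSub f g).1 U ↔ f.hom.app U x = g.hom.app U x := by
  change x ∈ secs (kernelSubobject _) U ↔ _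
  rw [secs_kernel, LinearMap.mem_ker]
  exact sub_eq_zero

/-- The image of a map of Cartier modules. -/
noncomputable def rangeSub {A B : CohCart s} (f : A ⟶ B) : B.CartierSubmodule :=
  have hq : (imageSubobject f.hom : X.Modules).IsQuasicoherent :=
    isQuasicoherent_of_localizes _ fun _ hU => localizes_image _ hU A.localizes B.localizes
  ⟨imageSubobject f.hom, hq, image_le_of_affine hq fun U hU x hx => by
      rw [secs_imageSubobject f hU] at hx ⊢
      obtain ⟨y, rfl⟩ := hx
      exact ⟨A.op U y, Hom.app_op f U y⟩⟩

end CohCart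

open CohCart

/-- Kernel and image are quasi-coherent, so nilpotence can be tested elementwise over affine opens,
with an exponent independent of the open. -/
theorem nilIso_iff {M N : CohCart s} (φ : M ⟶ N) : nilIso s φ ↔
    (∃ e, ∀ U, IsAffineOpen U → ∀ x, φ.hom.app U x = 0 → (M.op U)^[e] x = 0) ∧
    (∃ e, ∀ U, IsAffineOpen U → ∀ y, ∃ x, φ.hom.app U x = (N.op U)^[e] y) := by
  refine and_congr (exists_congr fun e => ?_) (exists_congr fun e => ?_)
  · rw [← le_bot_iff, imageIter_le_iff (isQuasicoherent_kernel N.coherent.quasicoherent _)]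
    refine forall₂_congr fun U hU => forall_congr' fun x => ?_
    rw [secs_kernel, secs_bot]
    rfl
  · rw [imageIter_le_iff N.isQuasicoherent_top]
    refine forall₂_congr fun U hU => forall_congr' fun x => ?_
    rw [secs_imageSubobject φ hU, secs_top]
    exact ⟨fun h => h trivial, fun h _ => h⟩

namespace CohCart

theorem mono_of_mono_hom {A B : CohCart s} (f : A ⟶ B) [Mono f.hom] : Mono f :=
  ⟨fun _ _ e => CohCart.Hom.ext ((cancel_mono f.hom).1 (congrArg CohCart.Hom.hom e))⟩

variable [IsLocallyNoetherian X] {M : CohCart s}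

theorem exists_incl_eq (N : M.CartierSubmodule) {U : X.Opens} {x : Γ(M.module, U)}
    (hx : x ∈ secs N.1 U) : ∃ y, N.incl.hom.app U y = x := hx

theorem incl_mem (N : M.CartierSubmodule) {U : X.Opens} (y : Γ(N.toCohCart.module, U)) :
    N.incl.hom.app U y ∈ secs N.1 U := ⟨y, rfl⟩

instance (N : M.CartierSubmodule) : Mono N.incl.hom :=
  inferInstanceAs (Mono N.1.arrow)

instance (N : M.CartierSubmodule) : Mono N.incl := mono_of_mono_hom _

theorem incl_injective (N : M.CartierSubmodule) (U : X.Opens) :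
    Function.Injective (N.incl.hom.app U) := app_injective N.incl.hom U

/-- A map whose values lie in a Cartier submodule factors through it. -/
theorem exists_factor {A : CohCart s} (f : A ⟶ M) (N : M.CartierSubmodule)
    (h : ∀ U x, f.hom.app U x ∈ secs N.1 U) : ∃ g : A ⟶ N.toCohCart, g ≫ N.incl = f := by
  have hf : N.1.Factors f.hom := (factors_iff N.1 f.hom).2 h
  let g : A.module ⟶ N.toCohCart.module := N.1.factorThru f.hom hf
  have hg : g ≫ N.incl.hom = f.hom := N.1.factorThru_arrow f.hom hf
  refine ⟨⟨g, ?_⟩, CohCart.Hom.ext hg⟩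
  rw [← cancel_mono N.incl.hom, Category.assoc, Category.assoc, hg, ← f.comm, ← N.incl.comm,
    ← hg, Functor.map_comp, Category.assoc]

end CohCart

end CartierModules

/-! ### Right fractions and monomorphisms. -/

section Fractions

variable {𝒞 𝒟 : Type*} [Category 𝒞] [Category 𝒟]

theorem CategoryTheory.Localization.exists_precomp_eq_map (L : 𝒞 ⥤ 𝒟) (W : MorphismProperty 𝒞)
    [L.IsLocalization W] [W.HasRightCalculusOfFractions] {A B : 𝒞} (g : L.obj A ⟶ L.obj B) :
    ∃ (Z : 𝒞) (t : Z ⟶ A) (_ : W t) (f : Z ⟶ B), L.map t ≫ g = L.map f := by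
  obtain ⟨φ, rfl⟩ := Localization.exists_rightFraction L W g
  exact ⟨φ.X', φ.s, φ.hs, φ.f, φ.map_s_comp_map L _⟩

/-- A localization functor with right calculus of fractions preserves monomorphisms. -/
theorem CategoryTheory.Localization.mono_map (L : 𝒞 ⥤ 𝒟) (W : MorphismProperty 𝒞)
    [L.IsLocalization W] [W.HasRightCalculusOfFractions] {A B : 𝒞} (i : A ⟶ B) [Mono i] :
    Mono (L.map i) := by
  have := Localization.essSurj L W
  constructor
  intro Z g h e
  let p := L.objObjPreimageIso Z
  -- Denominators are cleared successively, so that `g` and `h` are both represented on `Z₂`. After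
  -- `t₃` their composites with `i` agree in `𝒞`, where `i` cancels.
  obtain ⟨Z₁, t₁, ht₁, a, ha⟩ := Localization.exists_precomp_eq_map L W (p.hom ≫ g)
  obtain ⟨Z₂, t₂, ht₂, b, hb⟩ :=
    Localization.exists_precomp_eq_map L W (L.map t₁ ≫ p.hom ≫ h)
  have h₁ : L.map ((t₂ ≫ a) ≫ i) = L.map (b ≫ i) := by
    rw [L.map_comp, L.map_comp, L.map_comp, ← ha, ← hb]
    simp only [Category.assoc, e]
  obtain ⟨Z₃, t₃, ht₃, h₃⟩ := (MorphismProperty.map_eq_iff_precomp L W _ _).1 h₁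
  simp only [← Category.assoc, cancel_mono] at h₃
  have i₁ := Localization.inverts L W t₁ ht₁
  have i₂ := Localization.inverts L W t₂ ht₂
  have i₃ := Localization.inverts L W t₃ ht₃
  rw [← cancel_epi p.hom, ← cancel_epi (L.map t₁), ← cancel_epi (L.map t₂), hb, ha,
    ← cancel_epi (L.map t₃), ← L.map_comp, ← L.map_comp, ← Category.assoc, h₃, L.map_comp]

end Fractions

/-! ### Direct sums and the calculus of fractions for nil-isomorphisms. -/

namespace CartierModules
open AlgebraicGeometry.Scheme.Modules

variable {𝔽 : Type u} [Field 𝔽] [Fintype 𝔽] {X : Scheme.{u}} {s : X ⟶ Spec (CommRingCat.of 𝔽)}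

namespace CohCart

theorem inl_add_inr {A B : X.Modules} (U : X.Opens) (x : Γ(A ⊞ B, U)) :
    (biprod.inl : A ⟶ A ⊞ B).app U ((biprod.fst : A ⊞ B ⟶ A).app U x) +
      (biprod.inr : B ⟶ A ⊞ B).app U ((biprod.snd : A ⊞ B ⟶ B).app U x) = x :=
  congr(Hom.app $(biprod.total (X := A) (Y := B)) U x)

theorem fst_inl_add_inr {A B : X.Modules} (U : X.Opens) (a : Γ(A, U)) (b : Γ(B, U)) :
    (biprod.fst : A ⊞ B ⟶ A).app U ((biprod.inl : A ⟶ A ⊞ B).app U a +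
      (biprod.inr : B ⟶ A ⊞ B).app U b) = a := by
  rw [map_add]
  have h₁ : (biprod.fst : A ⊞ B ⟶ A).app U ((biprod.inl : A ⟶ A ⊞ B).app U a) = a :=
    congr(Hom.app $(biprod.inl_fst (X := A) (Y := B)) U a)
  have h₂ : (biprod.fst : A ⊞ B ⟶ A).app U ((biprod.inr : B ⟶ A ⊞ B).app U b) = 0 :=
    congr(Hom.app $(biprod.inr_fst (X := A) (Y := B)) U b)
  rw [h₁, h₂, add_zero]

theorem snd_inl_add_inr {A B : X.Modules} (U : X.Opens) (a : Γ(A, U)) (b : Γ(B, U)) :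
    (biprod.snd : A ⊞ B ⟶ B).app U ((biprod.inl : A ⟶ A ⊞ B).app U a +
      (biprod.inr : B ⟶ A ⊞ B).app U b) = b := by
  rw [map_add]
  have h₁ : (biprod.snd : A ⊞ B ⟶ B).app U ((biprod.inl : A ⟶ A ⊞ B).app U a) = 0 :=
    congr(Hom.app $(biprod.inl_snd (X := A) (Y := B)) U a)
  have h₂ : (biprod.snd : A ⊞ B ⟶ B).app U ((biprod.inr : B ⟶ A ⊞ B).app U b) = b :=
    congr(Hom.app $(biprod.inr_snd (X := A) (Y := B)) U b)
  rw [h₁, h₂, zero_add]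

theorem biprod_ext {A B : X.Modules} {U : X.Opens} {x y : Γ(A ⊞ B, U)}
    (h₁ : (biprod.fst : A ⊞ B ⟶ A).app U x = (biprod.fst : A ⊞ B ⟶ A).app U y)
    (h₂ : (biprod.snd : A ⊞ B ⟶ B).app U x = (biprod.snd : A ⊞ B ⟶ B).app U y) : x = y := by
  rw [← inl_add_inr U x, h₁, h₂, inl_add_inr]

theorem localizes_biprod {A B : X.Modules} {U : X.Opens} (hA : A.Localizes U)
    (hB : B.Localizes U) : (A ⊞ B).Localizes U := by
  intro f
  constructor
  · intro x
    obtain ⟨n, a, ha⟩ := (hA f).exists_res ((biprod.fst : A ⊞ B ⟶ A).app _ x)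
    obtain ⟨m, b, hb⟩ := (hB f).exists_res ((biprod.snd : A ⊞ B ⟶ B).app _ x)
    refine ⟨m + n, (biprod.inl : A ⟶ A ⊞ B).app U (f ^ m • a) +
      (biprod.inr : B ⟶ A ⊞ B).app U (f ^ n • b), biprod_ext ?_ ?_⟩
    · rw [app_res, fst_inl_add_inr, res_pow_smul, ha, smul_smul, ← pow_add]
      exact ((appLinear biprod.fst _).map_smul _ _).symm
    · rw [app_res, snd_inl_add_inr, res_pow_smul, hb, smul_smul, ← pow_add, add_comm n]
      exact ((appLinear biprod.snd _).map_smul _ _).symm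
  · intro t ht
    obtain ⟨n, hn⟩ := (hA f).exists_pow_smul ((biprod.fst : A ⊞ B ⟶ A).app _ t)
      (by rw [← app_res, ht, map_zero])
    obtain ⟨m, hm⟩ := (hB f).exists_pow_smul ((biprod.snd : A ⊞ B ⟶ B).app _ t)
      (by rw [← app_res, ht, map_zero])
    refine ⟨m + n, biprod_ext ?_ ?_⟩
    · rw [map_zero]
      refine ((appLinear biprod.fst _).map_smul _ _).trans ?_
      rw [pow_add, ← smul_smul, appLinear_apply, hn, smul_zero]
    · rw [map_zero]
      refine ((appLinear biprod.snd _).map_smul _ _).trans ?_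
      rw [add_comm, pow_add, ← smul_smul, appLinear_apply, hm, smul_zero]

theorem isCoherent_biprod [IsLocallyNoetherian X] {A B : X.Modules} (hA : IsCoherent A)
    (hB : IsCoherent B) :
    IsCoherent (A ⊞ B) where
  quasicoherent := isQuasicoherent_of_localizes _ fun _ hU => localizes_biprod
    (localizes_of_isQuasicoherent _ hA.quasicoherent hU)
    (localizes_of_isQuasicoherent _ hB.quasicoherent hU)
  finite U hU := by
    have : IsNoetherianRing Γ(X, U) := IsLocallyNoetherian.component_noetherian ⟨U, hU⟩
    have := hA.finite U hU
    have := hB.finite U hU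
    refine Module.Finite.of_injective
      ((appLinear (biprod.fst : A ⊞ B ⟶ A) U).prod (appLinear (biprod.snd : A ⊞ B ⟶ B) U))
      fun x y h => ?_
    exact biprod_ext (congrArg Prod.fst h) (congrArg Prod.snd h)

section DirectSum

variable [IsLocallyNoetherian X]

/-- The direct sum of coherent Cartier modules. -/
noncomputable def sum (A B : CohCart s) : CohCart s where
  module := A.module ⊞ B.module
  coherent := isCoherent_biprod A.coherent B.coherent
  C := biprod.lift ((Scheme.Modules.pushforward (frobenius s)).map biprod.fst ≫ A.C)
    ((Scheme.Modules.pushforward (frobenius s)).map biprod.snd ≫ B.C)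

/-- The first projection. -/
noncomputable def sumFst (A B : CohCart s) : sum A B ⟶ A := ⟨biprod.fst, (biprod.lift_fst ..).symm⟩

/-- The second projection. -/
noncomputable def sumSnd (A B : CohCart s) : sum A B ⟶ B := ⟨biprod.snd, (biprod.lift_snd ..).symm⟩

theorem sum_ext {A B : CohCart s} {U : X.Opens} {x y : Γ((sum A B).module, U)}
    (h₁ : (sumFst A B).hom.app U x = (sumFst A B).hom.app U y)
    (h₂ : (sumSnd A B).hom.app U x = (sumSnd A B).hom.app U y) : x = y :=
  biprod_ext h₁ h₂

theorem exists_sum_eq {A B : CohCart s} {U : X.Opens} (a : Γ(A.module, U)) (b : Γ(B.module, U)) :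
    ∃ x, (sumFst A B).hom.app U x = a ∧ (sumSnd A B).hom.app U x = b :=
  ⟨_, fst_inl_add_inr U a b, snd_inl_add_inr U a b⟩

end DirectSum

/-- The zero map of Cartier modules. -/
noncomputable def zeroHom (A B : CohCart s) : A ⟶ B := ⟨0, by simp⟩

theorem zeroHom_app (A B : CohCart s) (U : X.Opens) (x : Γ(A.module, U)) :
    (zeroHom A B).hom.app U x = 0 := rfl

end CohCart

open CohCart

instance : (nilIso s).IsMultiplicative where
  id_mem M := (nilIso_iff _).2 ⟨⟨0, fun _ _ _ h => h⟩, ⟨0, fun _ _ y => ⟨y, rfl⟩⟩⟩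
  comp_mem {A B D} f g hf hg := by
    obtain ⟨⟨e₁, h₁⟩, ⟨e₂, h₂⟩⟩ := (nilIso_iff f).1 hf
    obtain ⟨⟨e₃, h₃⟩, ⟨e₄, h₄⟩⟩ := (nilIso_iff g).1 hg
    refine (nilIso_iff _).2 ⟨⟨e₁ + e₃, fun U hU x hx => ?_⟩, ⟨e₂ + e₄, fun U hU y => ?_⟩⟩
    · rw [Function.iterate_add_apply]
      refine h₁ U hU _ ?_
      rw [Hom.app_iterate_op]
      exact h₃ U hU _ hx
    · obtain ⟨z, hz⟩ := h₄ U hU y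
      obtain ⟨x, hx⟩ := h₂ U hU z
      refine ⟨x, ?_⟩
      rw [comp_app, hx, Hom.app_iterate_op, hz, ← Function.iterate_add_apply]

theorem nilIso_incl [IsLocallyNoetherian X] {M : CohCart s} (N : M.CartierSubmodule)
    (h : ∃ e, ∀ U, IsAffineOpen U → ∀ x, (M.op U)^[e] x ∈ secs N.1 U) : nilIso s N.incl := by
  refine (nilIso_iff _).2 ⟨⟨0, fun U _ x hx => ?_⟩, h⟩
  exact incl_injective N U (hx.trans (map_zero _).symm)

instance [IsLocallyNoetherian X] : (nilIso s).HasRightCalculusOfFractions where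
  exists_rightFraction A B φ := by
    obtain ⟨⟨e₁, h₁⟩, ⟨e₂, h₂⟩⟩ := (nilIso_iff φ.s).1 φ.hs
    -- `P` is the fibre product of `φ.f` and `φ.s`. The kernel of its projection to `A` embeds in
    -- `ker φ.s`. The projection reaches `C^e₂(a)`, since `C^e₂` takes `φ.f(a)` into the image of
    -- `φ.s`.
    let P := eqSub (sumFst A B ≫ φ.f) (sumSnd A B ≫ φ.s)
    have hP {U : X.Opens} {x} : x ∈ secs P.1 U ↔ φ.f.hom.app U ((sumFst A B).hom.app U x) =
        φ.s.hom.app U ((sumSnd A B).hom.app U x) := mem_secs_eqSub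
    refine ⟨⟨P.incl ≫ sumFst A B, (nilIso_iff _).2 ⟨⟨e₁, fun U hU y hy => ?_⟩,
      ⟨e₂, fun U hU a => ?_⟩⟩, P.incl ≫ sumSnd A B⟩, ?_⟩
    · rw [comp_app] at hy
      have hmem := hP.1 (incl_mem P y)
      rw [hy, map_zero] at hmem
      apply incl_injective P U
      rw [Hom.app_iterate_op, map_zero]
      apply sum_ext
      · rw [Hom.app_iterate_op, hy, map_zero, iterate_map_zero]
      · rw [Hom.app_iterate_op, h₁ U hU _ hmem.symm, map_zero]
    · obtain ⟨b, hb⟩ := h₂ U hU (φ.f.hom.app U a)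
      obtain ⟨x, hx₁, hx₂⟩ := exists_sum_eq ((A.op U)^[e₂] a) b
      obtain ⟨y, hy⟩ := exists_incl_eq P (hP.2 (by rw [hx₁, hx₂, hb, Hom.app_iterate_op]))
      exact ⟨y, by rw [comp_app, hy, hx₁]⟩
    · refine CohCart.Hom.ext (hom_ext_apply fun U y => ?_)
      exact hP.1 (incl_mem P y)
  ext A B D f g w hw h := by
    obtain ⟨⟨e, he⟩, -⟩ := (nilIso_iff w).1 hw
    -- `f - g` takes values in `ker w`, which `C^e` kills, so `f` and `g` agree on `C^e` of their
    -- source.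
    refine ⟨_, (eqSub f g).incl, nilIso_incl _ ⟨e, fun U hU x => ?_⟩, ?_⟩
    · have hx : w.hom.app U (f.hom.app U x - g.hom.app U x) = 0 := by
        rw [map_sub, sub_eq_zero, ← comp_app, h, comp_app]
      rw [mem_secs_eqSub, Hom.app_iterate_op, Hom.app_iterate_op, ← sub_eq_zero,
        ← he U hU _ hx, iterate_map_sub]
    · refine CohCart.Hom.ext (hom_ext_apply fun U y => ?_)
      rw [comp_app, comp_app]
      exact mem_secs_eqSub.1 (incl_mem (eqSub f g) y)

/-! ### Subcrystals and fixed submodules. -/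

namespace CohCart

section Subcrystals

variable [IsLocallyNoetherian X] {M : CohCart s}

theorem mono_map_incl (N : M.CartierSubmodule) : Mono ((toCrys s).map N.incl) :=
  Localization.mono_map _ (nilIso s) N.incl

attribute [local instance] mono_map_incl

/-- The subcrystal attached to a Cartier submodule. -/
noncomputable def subcrystal (N : M.CartierSubmodule) : Subobject ((toCrys s).obj M) :=
  Subobject.mk ((toCrys s).map N.incl)

/-- Write the comparison map as a right fraction. After a further nil-isomorphism the two maps to
`M` agree as maps of modules, and the resulting nil-isomorphism onto `N` reaches `C^e(N)`. -/
theorem exists_imageIter_le_of_subcrystal_le {N N' : M.CartierSubmodule}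
    (h : subcrystal N ≤ subcrystal N') :
    ∃ e, M.imageIter e N.1 ≤ N'.1 := by
  have h : Subobject.mk ((toCrys s).map N.incl) ≤ Subobject.mk ((toCrys s).map N'.incl) := h
  obtain ⟨Z, t, ht, a, ha⟩ := Localization.exists_precomp_eq_map (toCrys s) (nilIso s)
    (Subobject.ofMkLEMk _ _ h)
  have hQ : (toCrys s).map (t ≫ N.incl) = (toCrys s).map (a ≫ N'.incl) := by
    rw [Functor.map_comp, Functor.map_comp, ← ha, Category.assoc, Subobject.ofMkLEMk_comp]
  obtain ⟨Z', t', ht', h'⟩ := (MorphismProperty.map_eq_iff_precomp _ (nilIso s) _ _).1 hQ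
  obtain ⟨-, ⟨e, he⟩⟩ := (nilIso_iff _).1 ((nilIso s).comp_mem t' t ht' ht)
  refine ⟨e, (imageIter_le_iff N.2.1 e).2 fun U hU x hx => ?_⟩
  obtain ⟨y, rfl⟩ := exists_incl_eq N hx
  obtain ⟨z, hz⟩ := he U hU y
  rw [← Hom.app_iterate_op, ← hz, ← comp_app, Category.assoc, h', ← Category.assoc, comp_app]
  exact incl_mem N' _

theorem subcrystal_mono {N N' : M.CartierSubmodule} (h : N.1 ≤ N'.1) :
    subcrystal N ≤ subcrystal N' := by
  obtain ⟨g, hg⟩ := exists_factor N.incl N' fun U x => le_iff_secs.1 h U (incl_mem N x)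
  exact Subobject.mk_le_mk_of_comm ((toCrys s).map g) (by rw [← Functor.map_comp, hg])

/-- The inclusion of `N` in `N'` is injective with nilpotent cokernel, so it becomes invertible. -/
theorem subcrystal_eq {N N' : M.CartierSubmodule} (h : N.1 ≤ N'.1) {e : ℕ}
    (he : M.imageIter e N'.1 ≤ N.1) : subcrystal N = subcrystal N' := by
  refine le_antisymm (subcrystal_mono h) ?_
  obtain ⟨g, hg⟩ := exists_factor N.incl N' fun U x => le_iff_secs.1 h U (incl_mem N x)
  have hnil : nilIso s g := by
    refine (nilIso_iff _).2 ⟨⟨0, fun U _ x hx => incl_injective N U ?_⟩, ⟨e, fun U hU y => ?_⟩⟩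
    · rw [Function.iterate_zero_apply, ← hg, comp_app, hx, map_zero, map_zero]
    · obtain ⟨x, hx⟩ := exists_incl_eq N ((imageIter_le_iff N'.2.1 e).1 he U hU _ (incl_mem N' y))
      refine ⟨x, incl_injective N' U ?_⟩
      rw [← comp_app, hg, hx, Hom.app_iterate_op]
  have := Localization.inverts (toCrys s) (nilIso s) g hnil
  refine Subobject.mk_le_mk_of_comm (inv ((toCrys s).map g)) ?_
  rw [IsIso.inv_comp_eq, ← Functor.map_comp, hg]

/-- Up to isomorphism of the source, the inclusion of `S` is represented by a map `f` of modules,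
and the image of `f` is the required submodule. -/
theorem exists_subcrystal_eq (S : Subobject ((toCrys s).obj M)) :
    ∃ N : M.CartierSubmodule, subcrystal N = S := by
  have := Localization.essSurj (toCrys s) (nilIso s)
  let p := (toCrys s).objObjPreimageIso (S : Crys s)
  obtain ⟨Z, t, ht, f, hf⟩ :=
    Localization.exists_precomp_eq_map (toCrys s) (nilIso s) (p.hom ≫ S.arrow)
  have := Localization.inverts (toCrys s) (nilIso s) t ht
  have hmono : Mono ((toCrys s).map f) := hf ▸ inferInstance
  obtain ⟨g, hg⟩ := exists_factor f (rangeSub f) fun U x =>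
    (mem_secs_image _ _).2 fun p hp => ⟨U, le_rfl, hp, by rw [res_self]; exact ⟨x, rfl⟩⟩
  -- Only nilpotence of `K = ker f` is at issue. `f` is mono on crystals, so the inclusion of `K`
  -- becomes zero there, hence is zero after a nil-isomorphism `w` into `K`, whose image contains
  -- `C^e(K)`.
  have hnil : nilIso s g := by
    let K := eqSub f (zeroHom Z M)
    have hK : K.incl ≫ f = zeroHom _ _ ≫ f := CohCart.Hom.ext <| hom_ext_apply fun U y => by
      rw [comp_app, comp_app, zeroHom_app, map_zero]
      exact mem_secs_eqSub.1 (incl_mem K y)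
    have hK' : (toCrys s).map K.incl = (toCrys s).map (zeroHom _ _) := by
      rw [← cancel_mono ((toCrys s).map f), ← Functor.map_comp, hK, Functor.map_comp]
    obtain ⟨Z', w, hw, h⟩ := (MorphismProperty.map_eq_iff_precomp _ (nilIso s) _ _).1 hK'
    obtain ⟨-, ⟨e, he⟩⟩ := (nilIso_iff w).1 hw
    refine (nilIso_iff g).2 ⟨⟨e, fun U hU x hx => ?_⟩, ⟨0, fun U hU y => ?_⟩⟩
    · have hfx : f.hom.app U x = 0 := by rw [← hg, comp_app, hx, map_zero]
      obtain ⟨k, rfl⟩ := exists_incl_eq K (mem_secs_eqSub.2 hfx)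
      obtain ⟨z, hz⟩ := he U hU k
      rw [← Hom.app_iterate_op, ← hz, ← comp_app, h, comp_app, zeroHom_app]
    · obtain ⟨x, hx⟩ := (secs_imageSubobject f hU).le (incl_mem (rangeSub f) y)
      refine ⟨x, incl_injective _ U ?_⟩
      rw [← comp_app, hg]
      exact hx
  have := Localization.inverts (toCrys s) (nilIso s) g hnil
  refine ⟨rangeSub f, ?_⟩
  rw [← Subobject.mk_arrow S]
  refine Subobject.mk_eq_mk_of_comm _ _ ((asIso ((toCrys s).map g)).symm ≪≫
    asIso ((toCrys s).map t) ≪≫ p) ?_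
  simp only [Iso.trans_hom, Iso.symm_hom, asIso_inv, asIso_hom, Category.assoc]
  rw [hf, IsIso.inv_comp_eq, ← Functor.map_comp, hg]

end Subcrystals

theorem subcrystal_le_iff [IsLocallyNoetherian X] {M : CohCart s} {N N' : M.FixedSubmodule} :
    subcrystal N.toCartierSubmodule ≤ subcrystal N'.toCartierSubmodule ↔ N ≤ N' := by
  refine ⟨fun h => ?_, fun h => subcrystal_mono h⟩
  obtain ⟨e, he⟩ := exists_imageIter_le_of_subcrystal_le h
  exact (imageIter_eq_self N e).ge.trans he

/-- Fixed submodules correspond to subcrystals. -/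
noncomputable def fixedSubmoduleOrderIso [IsNoetherian X] (M : CohCart s) :
    M.FixedSubmodule ≃o Subobject ((toCrys s).obj M) :=
  RelIso.ofSurjective (OrderEmbedding.ofMapLEIff (fun N => subcrystal N.toCartierSubmodule)
    fun _ _ => subcrystal_le_iff) fun S => by
      obtain ⟨N, rfl⟩ := exists_subcrystal_eq S
      obtain ⟨L, e, he⟩ := exists_stable N
      have := he e le_rfl
      -- The stable value of `N` defines the same subcrystal as `N`, which gives surjectivity.
      exact ⟨L, subcrystal_eq (this.ge.trans (imageIter_le N e)) this.le⟩

end CohCart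

end CartierModules

theorem corollary4p20 {𝔽 : Type u} [Field 𝔽] [Fintype 𝔽] {X : Scheme.{u}} [IsNoetherian X]
    (s : X ⟶ Spec (CommRingCat.of 𝔽)) [IsFinite (CartierModules.frobenius s)] :
    (∀ M : CartierModules.CohCart s, Finite M.FixedSubmodule) ∧
    (∀ M : CartierModules.CohCart s, Finite (Quotient M.equalUpToNilpotence)) ∧
    (∀ 𝓜 : CartierModules.Crys s, Finite (Subobject 𝓜)) ∧
    (∀ M : CartierModules.CohCart s,
      ∃ _ : ∀ N : M.CartierSubmodule, Mono ((CartierModules.toCrys s).map N.incl),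
      ∃ e : M.FixedSubmodule ≃o Subobject ((CartierModules.toCrys s).obj M),
        ∀ N : M.FixedSubmodule,
          e N = Subobject.mk ((CartierModules.toCrys s).map N.toCartierSubmodule.incl)) := by
  refine ⟨fun M => M.finite_fixedSubmodule, fun M => M.finite_quotient, fun 𝓜 => ?_,
    fun M => ⟨CartierModules.CohCart.mono_map_incl, M.fixedSubmoduleOrderIso, fun N => rfl⟩⟩
  -- Every crystal is isomorphic to that of some module, so the third claim follows from the first
  -- through the order isomorphism.
  have := Localization.essSurj (CartierModules.toCrys s) (CartierModules.nilIso s)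
  let p := (CartierModules.toCrys s).objObjPreimageIso 𝓜
  have := CartierModules.CohCart.finite_fixedSubmodule ((CartierModules.toCrys s).objPreimage 𝓜)
  exact Finite.of_equiv _ ((CartierModules.CohCart.fixedSubmoduleOrderIso _).trans
    (Subobject.mapIsoToOrderIso p)).toEquiv
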